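/- Let $g>0$, $\mu>0$, and let $\bar\rho\in C^\infty(\mathbb R)\cap L^\infty(\mathbb R)$ be real-valued with $\bar\rho'\in C_0^\infty(\mathbb R)$, $\inf_{\mathbb R}\bar\rho>0$ and $\bar\rho'(x^0)>0$ for some $x^0\in\mathbb R$. Put $$M_{\mathrm c}:=\Big(\sup_{0\not\equiv\psi\in H^1(\mathbb R)}\frac{\int_{\mathbb R} g\bar\rho'\psi^2\,dx}{\int_{\mathbb R}|\psi'|^2\,dx}\Big)^{1/2}\in(0,\infty].$$ Let the constant magnetic field $\bar{\mathbf M}$ be either $M\mathbf e_1$ with $M\neq0$ (horizontal case) or $M\mathbf e_3$ with $0<|M|<M_{\mathrm c}$ (vertical case). For $\xi=(\xi_1,\xi_2)\in\mathbb R^2$ with $0<|M\xi_1|/|\xi|<M_{\mathrm c}$ (horizontal case) put $$S(\xi):=\Big(\sup_{0\not\equiv\psi\in H^1(\mathbb R)}\frac{\frac{g|\xi|^2}{(M\xi_1)^2}\int\bar\rho'\psi^2\,dx-\int|\psi'|^2\,dx}{\int\psi^2\,dx}\Big)^{1/2},$$ and in the vertical case put $$|\xi|^M_{\mathrm{vc}}:=\Big(\inf\Big\{\frac{M^2\int|\psi''|^2\,dx}{\int(g\bar\rho'\psi^2-M^2|\psi'|^2)\,dx}\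 :\ \psi\in H^2(\mathbb R),\ \int(g\bar\rho'\psi^2-M^2|\psi'|^2)\,dx>0\Big\}\Big)^{1/2}.$$ The solvable domain is $$\mathbb A^{\mathrm g}:=\begin{cases}\big(\{\xi: 0<|M\xi_1|/|\xi|<M_{\mathrm c},\ |\xi|<S(\xi)\}\cup\{\xi:\xi_1=0\}\big)\setminus\{\mathbf 0\}&\text{(horizontal case)},\\ \{\xi: |\xi|>|\xi|^M_{\mathrm{vc}}\}&\text{(vertical case)}.\end{cases}$$ For $\xi\ne \mathbf 0$ let $\mathcal A:=\{\psi\in H^2(\mathbb R): \int_{\mathbb R}\bar\rho(|\xi|^2\psi^2+|\psi'|^2)\,dx=1\}$ and, for $s>0$, $E(\psi,s):=|\xi|^2E_0(\psi)+s\mu\int_{\mathbb R}\big(4|\xi|^2|\psi'|^2+(|\xi|^2\psi+\psi'')^2\big)dx$, where $E_0(\psi)=\int_{\mathbb R} M^2\xi_1^2\big(\psi^2+|\psi'|^2/|\xi|^2\big)-g\bar\rho'\psi^2\,dx$ in the horizontal case and $E_0(\psi)=\int_{\mathbb R} M^2\big(|\psi'|^2+|\psi''|^2/|\xi|^2\big)-g\bar\rho'\psi^2\,dx$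 in the vertical case. Theorem. For each $\xi\in\mathbb A^{\mathrm g}$ there are a number $\lambda=\lambda(\xi)>0$ with $-\lambda^2=\inf_{\psi\in\mathcal A}E(\psi,\lambda)$ and real-valued smooth functions $\varphi,\theta,\psi,\pi\in H^\infty(\mathbb R)=\bigcap_{k\ge0}H^k(\mathbb R)$ with $\psi\in\mathcal A$ that solve on $\mathbb R$ the system $$\begin{cases}\lambda^2\bar\rho\varphi-\lambda\xi_1\pi+\lambda\mu(|\xi|^2\varphi-\varphi'')=M^2B_1,\\ \lambda^2\bar\rho\theta-\lambda\xi_2\pi+\lambda\mu(|\xi|^2\theta-\theta'')=M^2B_2,\\ \lambda^2\bar\rho\psi+\lambda\pi'+\lambda\mu(|\xi|^2\psi-\psi'')-g\bar\rho'\psi=M^2B_3,\\ \xi_1\varphi+\xi_2\theta+\psi'=0,\end{cases}$$ with $\varphi(\pm\infty)=\theta(\pm\infty)=\psi(\pm\infty)=0$, where $(B_1,B_2,B_3)=\big(0,\ \xi_1\xi_2\varphi-\xi_1^2\theta,\ -(\xi_1^2\psi+\xi_1\varphi')\big)$ in the horizontal case and $(B_1,B_2,B_3)=\big(\varphi''+\xi_1\psi',\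 \theta''+\xi_2\psi',\ 0\big)$ in the vertical case. -/

import Mathlib

open MeasureTheory Filter Topology
open scoped ContDiff ENNReal

noncomputable section

namespace RTMHD

/-- `f'` is a weak derivative of `f` on the real line. -/
def IsWeakDeriv (f f' : ℝ → ℝ) : Prop :=
  LocallyIntegrable f volume ∧ LocallyIntegrable f' volume ∧
    ∀ η : ℝ → ℝ, ContDiff ℝ ∞ η → HasCompactSupport η →
      ∫ x, f x * deriv η x = -∫ x, f' x * η x

open Classical in
/-- A weak derivative of `f`, unique up to null sets (and `0` if `f` has none). -/
def weakDeriv (f : ℝ → ℝ) : ℝ → ℝ :=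
  if h : ∃ f', IsWeakDeriv f f' then h.choose else 0

/-- `f ∈ H^k(ℝ)`: `f` and its weak derivatives up to order `k` are square integrable. -/
def MemH : ℕ → (ℝ → ℝ) → Prop
  | 0, f => MemLp f 2 volume
  | k + 1, f => MemLp f 2 volume ∧ ∃ f', IsWeakDeriv f f' ∧ MemH k f'

/-- `f ∈ H^∞(ℝ) = ⋂ₖ H^k(ℝ)`. -/
def MemHInfty (f : ℝ → ℝ) : Prop := ∀ k : ℕ, MemH k f

/-- Smooth bounded Rayleigh–Taylor density profile `ρ̄` with `ρ̄' ∈ C₀^∞(ℝ)`, `inf ρ̄ > 0` and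
`ρ̄' > 0` at some point. -/
structure IsRTProfile (ρ : ℝ → ℝ) : Prop where
  smooth : ContDiff ℝ ∞ ρ
  bounded : MemLp ρ ⊤ volume
  compact_deriv : HasCompactSupport (deriv ρ)
  inf_pos : ∃ c : ℝ, 0 < c ∧ ∀ x, c ≤ ρ x
  exists_deriv_pos : ∃ x₀, 0 < deriv ρ x₀

/-- Direction of the constant magnetic field: `M e₁` (horizontal) or `M e₃` (vertical). -/
inductive FieldDir
  | horizontal
  | vertical

/-- The horizontal frequency plane `ℝ²` with its Euclidean norm; `ξ 0` and `ξ 1` are the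
components `ξ₁` and `ξ₂`. -/
abbrev Freq := EuclideanSpace ℝ (Fin 2)

/-- The critical number `M_c ∈ [0, ∞]`, the square root of the supremum of
`∫ g ρ̄' ψ² / ∫ |ψ'|²` over nonzero `ψ ∈ H¹(ℝ)`. Negative quotients, replaced by `0` here, do not
affect the supremum, which is positive because `ρ̄'` is positive somewhere. -/
def criticalNumber (g : ℝ) (ρ : ℝ → ℝ) : ℝ≥0∞ :=
  (⨆ (ψ : ℝ → ℝ) (_ : MemH 1 ψ ∧ ¬ ψ =ᵐ[volume] 0),
    ENNReal.ofReal ((∫ x, g * deriv ρ x * ψ x ^ 2) / ∫ x, weakDeriv ψ x ^ 2)) ^ (1 / 2 : ℝ)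

/-- The critical frequency function `S(ξ)` (horizontal field), used only where
`0 < |M ξ₁| / |ξ| < M_c`. -/
def criticalFreqFun (g M : ℝ) (ρ : ℝ → ℝ) (ξ : Freq) : ℝ :=
  Real.sqrt (sSup {q : ℝ | ∃ ψ : ℝ → ℝ, MemH 1 ψ ∧ ¬ ψ =ᵐ[volume] 0 ∧
    q = (g * ‖ξ‖ ^ 2 * (∫ x, deriv ρ x * ψ x ^ 2) / (M * ξ 0) ^ 2
          - ∫ x, weakDeriv ψ x ^ 2) / ∫ x, ψ x ^ 2})

/-- The critical frequency constant `|ξ|_vc^M` (vertical field), used only for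
`0 < |M| < M_c`. -/
def criticalFreqConst (g M : ℝ) (ρ : ℝ → ℝ) : ℝ :=
  Real.sqrt (sInf {q : ℝ | ∃ ψ : ℝ → ℝ, MemH 2 ψ ∧
    0 < (∫ x, (g * deriv ρ x * ψ x ^ 2 - M ^ 2 * weakDeriv ψ x ^ 2)) ∧
    q = (M ^ 2 * ∫ x, weakDeriv (weakDeriv ψ) x ^ 2) /
          ∫ x, (g * deriv ρ x * ψ x ^ 2 - M ^ 2 * weakDeriv ψ x ^ 2)})

/-- The admissible field strengths: `M ≠ 0` for `M e₁`, and `0 < |M| < M_c` for `M e₃`. -/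
def AdmissibleField (g : ℝ) (ρ : ℝ → ℝ) (M : ℝ) : FieldDir → Prop
  | .horizontal => M ≠ 0
  | .vertical => 0 < |M| ∧ ENNReal.ofReal |M| < criticalNumber g ρ

/-- The solvable domain `𝔸^g ⊆ ℝ²`. -/
def solvableDomain (g M : ℝ) (ρ : ℝ → ℝ) : FieldDir → Set Freq
  | .horizontal =>
      ({ξ | 0 < |ξ 0 * M| / ‖ξ‖ ∧ ENNReal.ofReal (|ξ 0 * M| / ‖ξ‖) < criticalNumber g ρ ∧
          ‖ξ‖ < criticalFreqFun g M ρ ξ} ∪ {ξ | ξ 0 = 0}) \ {0}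
  | .vertical => {ξ | criticalFreqConst g M ρ < ‖ξ‖}

/-- The functional `J(ψ) = ∫ ρ̄ (|ξ|² ψ² + |ψ'|²)`. -/
def J (ρ : ℝ → ℝ) (ξ : Freq) (ψ : ℝ → ℝ) : ℝ :=
  ∫ x, ρ x * (‖ξ‖ ^ 2 * ψ x ^ 2 + weakDeriv ψ x ^ 2)

/-- The admissible set `𝒜 = {ψ ∈ H²(ℝ) | J(ψ) = 1}`. -/
def admissibleSet (ρ : ℝ → ℝ) (ξ : Freq) : Set (ℝ → ℝ) :=
  {ψ | MemH 2 ψ ∧ J ρ ξ ψ = 1}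

/-- The functional `E₀`. -/
def E₀ (g M : ℝ) (ρ : ℝ → ℝ) (ξ : Freq) : FieldDir → (ℝ → ℝ) → ℝ
  | .horizontal, ψ =>
      ∫ x, (M ^ 2 * ξ 0 ^ 2 * (ψ x ^ 2 + weakDeriv ψ x ^ 2 / ‖ξ‖ ^ 2)
        - g * deriv ρ x * ψ x ^ 2)
  | .vertical, ψ =>
      ∫ x, (M ^ 2 * (weakDeriv ψ x ^ 2 + weakDeriv (weakDeriv ψ) x ^ 2 / ‖ξ‖ ^ 2)
        - g * deriv ρ x * ψ x ^ 2)

/-- The functional `E₁`. -/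
def E₁ (μ : ℝ) (ξ : Freq) (ψ : ℝ → ℝ) : ℝ :=
  μ * ∫ x, (4 * ‖ξ‖ ^ 2 * weakDeriv ψ x ^ 2 +
    (‖ξ‖ ^ 2 * ψ x + weakDeriv (weakDeriv ψ) x) ^ 2)

/-- The energy `E(ψ, s) = |ξ|² E₀(ψ) + s E₁(ψ)`. -/
def E (g μ M : ℝ) (ρ : ℝ → ℝ) (dir : FieldDir) (ξ : Freq) (s : ℝ) (ψ : ℝ → ℝ) : ℝ :=
  ‖ξ‖ ^ 2 * E₀ g M ρ ξ dir ψ + s * E₁ μ ξ ψ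

/-- `lam` is the growth rate `λ(ξ)`: the positive number with
`-λ² = inf_{ψ ∈ 𝒜} E(ψ, λ)`. -/
def IsGrowthRate (g μ M : ℝ) (ρ : ℝ → ℝ) (dir : FieldDir) (ξ : Freq) (lam : ℝ) : Prop :=
  0 < lam ∧ IsGLB (E g μ M ρ dir ξ lam '' admissibleSet ρ ξ) (-lam ^ 2)

/-- The magnetic term `B₁`. -/
def B₁ (ξ : Freq) (φ ψ : ℝ → ℝ) : FieldDir → ℝ → ℝ
  | .horizontal, _ => 0
  | .vertical, x => deriv (deriv φ) x + ξ 0 * deriv ψ x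

/-- The magnetic term `B₂`. -/
def B₂ (ξ : Freq) (φ θ ψ : ℝ → ℝ) : FieldDir → ℝ → ℝ
  | .horizontal, x => ξ 0 * ξ 1 * φ x - ξ 0 ^ 2 * θ x
  | .vertical, x => deriv (deriv θ) x + ξ 1 * deriv ψ x

/-- The magnetic term `B₃`. -/
def B₃ (ξ : Freq) (φ ψ : ℝ → ℝ) : FieldDir → ℝ → ℝ
  | .horizontal, x => -(ξ 0 ^ 2 * ψ x + ξ 0 * deriv φ x)
  | .vertical, _ => 0

/-- `(φ, θ, ψ, p)` is a smooth solution, with growth parameter `lam`, of the normal-mode system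
on `ℝ`, with `φ, θ, ψ` vanishing at `±∞`; `p` is the pressure amplitude `π`. -/
structure IsNormalMode (g μ M : ℝ) (ρ : ℝ → ℝ) (dir : FieldDir) (ξ : Freq) (lam : ℝ)
    (φ θ ψ p : ℝ → ℝ) : Prop where
  smooth_φ : ContDiff ℝ ∞ φ
  smooth_θ : ContDiff ℝ ∞ θ
  smooth_ψ : ContDiff ℝ ∞ ψ
  smooth_p : ContDiff ℝ ∞ p
  eq₁ : ∀ x, lam ^ 2 * ρ x * φ x - lam * ξ 0 * p x
      + lam * μ * (‖ξ‖ ^ 2 * φ x - deriv (deriv φ) x) = M ^ 2 * B₁ ξ φ ψ dir x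
  eq₂ : ∀ x, lam ^ 2 * ρ x * θ x - lam * ξ 1 * p x
      + lam * μ * (‖ξ‖ ^ 2 * θ x - deriv (deriv θ) x) = M ^ 2 * B₂ ξ φ θ ψ dir x
  eq₃ : ∀ x, lam ^ 2 * ρ x * ψ x + lam * deriv p x
      + lam * μ * (‖ξ‖ ^ 2 * ψ x - deriv (deriv ψ) x) - g * deriv ρ x * ψ x
        = M ^ 2 * B₃ ξ φ ψ dir x
  eq₄ : ∀ x, ξ 0 * φ x + ξ 1 * θ x + deriv ψ x = 0
  φ_bot : Tendsto φ atBot (𝓝 0)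
  θ_bot : Tendsto θ atBot (𝓝 0)
  ψ_bot : Tendsto ψ atBot (𝓝 0)
  φ_top : Tendsto φ atTop (𝓝 0)
  θ_top : Tendsto θ atTop (𝓝 0)
  ψ_top : Tendsto ψ atTop (𝓝 0)

end RTMHD

end

/-! Multiplied by `|ξ|²`, the energy becomes a quadratic pencil on `H²`. Write `j` for `J`, `e` for
`E₁`, `c` for the magnetic energy, `b` for `g|ξ|² ∫ ρ̄' ψ²`, and `q_s = s² j + s e + c - b`. By
homogeneity, `-λ²` is the infimum of `E(·, λ)` on `𝒜`, attained there, exactly when `q_λ ≥ 0` and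
`q_λ` vanishes at some `ψ` with `j(ψ) = 1`.

Instead of minimizing at fixed `s` and then solving a fixed-point equation in `s`, take `λ` to be
the supremum of the `s > 0` at which `q_s` takes a negative value. Such `s` exist because `c - b` is
negative somewhere: this is what membership in `𝔸^g` provides (`exists_formC_lt_formB`, which needs
the density of `H²` in `H¹`). They are bounded because `b ≤ K j`. By continuity `q_λ ≥ 0`, and there
are unit vectors along which `q_λ` tends to `0`. Since `j + e` is coercive on `H²` and `b` is
compact (Rellich, as `ρ̄'` has compact support), a subsequence converges in norm to a nonzero zero
of `q_λ`. A zero of a nonnegative form lies in its kernel (`exists_critical_parameter_normalized`).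

The kernel condition is the weak form of a fourth-order linear ODE. The du Bois-Reymond lemma makes
the solution classical (`exists_classical_solution`), and bootstrapping puts it in `C^∞ ∩ H^∞`.
Finally `(φ, θ) = -(ψ'/|ξ|²) ξ` satisfies the divergence equation, the pressure is read off from the
first two momentum equations, and the third one is then the ODE divided by `|ξ|²`
(`isNormalMode_of_fourth_order`). -/

noncomputable section

namespace RTMHD

open scoped RealInnerProductSpace

/-! ### Test functions and weak derivatives on the line -/

/-- Smooth compactly supported test functions. -/
structure IsTest (η : ℝ → ℝ) : Prop where
  smooth : ContDiff ℝ ∞ η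
  compact : HasCompactSupport η

namespace IsTest

variable {η ζ : ℝ → ℝ}

theorem deriv (hη : IsTest η) : IsTest (deriv η) :=
  ⟨(contDiff_infty_iff_deriv.1 hη.smooth).2, hη.compact.deriv⟩

theorem continuous (hη : IsTest η) : Continuous η := hη.smooth.continuous

theorem hasDerivAt (hη : IsTest η) (x : ℝ) : HasDerivAt η (_root_.deriv η x) x :=
  (hη.smooth.differentiable (by simp) x).hasDerivAt

theorem mul_left {p : ℝ → ℝ} (hp : ContDiff ℝ ∞ p) (hη : IsTest η) :
    IsTest (fun x => p x * η x) :=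
  ⟨hp.mul hη.smooth, hη.compact.mul_left⟩

theorem sub_const_mul (hη : IsTest η) (hζ : IsTest ζ) (c : ℝ) :
    IsTest (fun x => η x - c * ζ x) :=
  ⟨hη.smooth.sub (contDiff_const.mul hζ.smooth),
    hη.compact.sub (hζ.compact.mul_left (f := fun _ => c))⟩

theorem integrable (hη : IsTest η) : Integrable η :=
  hη.continuous.integrable_of_hasCompactSupport hη.compact

theorem memLp (hη : IsTest η) (p : ℝ≥0∞) : MemLp η p volume :=
  hη.continuous.memLp_of_hasCompactSupport hη.compact

theorem integrable_mul {f : ℝ → ℝ} (hf : LocallyIntegrable f) (hη : IsTest η) :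
    Integrable (fun x => f x * η x) := by
  simpa [mul_comm] using hf.integrable_smul_left_of_hasCompactSupport hη.continuous hη.compact

theorem exists_support (hη : IsTest η) :
    ∃ R : ℝ, 0 < R ∧ ∀ x, R ≤ |x| → η x = 0 := by
  obtain ⟨R, hR⟩ := hη.compact.isCompact.isBounded.subset_ball 0
  refine ⟨max R 1, by positivity, fun x hx => ?_⟩
  by_contra h
  have := hR (subset_tsupport _ h)
  simp at this
  have := le_max_left R 1
  linarith

end IsTest

theorem exists_isTest_integral_eq_one : ∃ θ : ℝ → ℝ, IsTest θ ∧ ∫ x, θ x = 1 := by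
  let f : ContDiffBump (0 : ℝ) := ⟨1, 2, one_pos, one_lt_two⟩
  exact ⟨f.normed volume, ⟨f.contDiff_normed, f.hasCompactSupport_normed⟩, f.integral_normed⟩

/-- The primitive of a locally integrable function has that function as weak derivative. -/
theorem isWeakDeriv_primitive {f : ℝ → ℝ} (hf : LocallyIntegrable f) (c : ℝ) :
    IsWeakDeriv (fun x => c + ∫ t in (0 : ℝ)..x, f t) f := by
  have hii : ∀ a b, IntervalIntegrable f volume a b := fun a b =>
    (hf.integrableOn_isCompact isCompact_uIcc).intervalIntegrable
  have hcont : Continuous fun x => c + ∫ t in (0 : ℝ)..x, f t :=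
    continuous_const.add (intervalIntegral.continuous_primitive hii 0)
  refine ⟨hcont.locallyIntegrable, hf, fun η h1 h2 => ?_⟩
  have hη : IsTest η := ⟨h1, h2⟩
  obtain ⟨R, hR, hz⟩ := hη.exists_support
  obtain ⟨R', hR', hz'⟩ := hη.deriv.exists_support
  set S := max R R'
  have key : ∀ h : ℝ → ℝ, (∀ x, S ≤ |x| → h x = 0) → ∫ x, h x = ∫ x in (-S)..S, h x := by
    intro h hh
    rw [intervalIntegral.integral_of_le (by have := le_max_left R R'; linarith),
      setIntegral_eq_integral_of_forall_compl_eq_zero]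
    intro x hx
    refine hh x ?_
    by_contra hlt
    push Not at hlt
    exact hx ⟨(abs_lt.1 hlt).1, (abs_lt.1 hlt).2.le⟩
  rw [key _ (fun x hx => by rw [hz' x ((le_max_right _ _).trans hx), mul_zero]),
    key _ (fun x hx => by rw [hz x ((le_max_left _ _).trans hx), mul_zero])]
  have hS : 0 ≤ S := hR.le.trans (le_max_left _ _)
  -- The primitive is only absolutely continuous, which suffices for integration by parts on an
  -- interval containing the supports of `η` and `η'`.
  have hac : AbsolutelyContinuousOnInterval (fun x => c + ∫ t in (0 : ℝ)..x, f t) (-S) S := by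
    have h0 : AbsolutelyContinuousOnInterval (fun _ : ℝ => c) (-S) S :=
      (contDiff_const (n := 1)).contDiffOn.absolutelyContinuousOnInterval
    exact h0.add ((hii (-S) S).absolutelyContinuousOnInterval_intervalIntegral
      (by rw [Set.uIcc_of_le (by linarith)]; exact ⟨by linarith, hS⟩))
  have hacη : AbsolutelyContinuousOnInterval η (-S) S :=
    (h1.of_le (mod_cast le_top) : ContDiff ℝ 1 η).contDiffOn.absolutelyContinuousOnInterval
  rw [hac.integral_mul_deriv_eq_deriv_mul hacη,
    hz S (by rw [abs_of_nonneg hS]; exact le_max_left _ _),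
    hz (-S) (by rw [abs_neg, abs_of_nonneg hS]; exact le_max_left _ _)]
  simp only [mul_zero, sub_zero, zero_sub, neg_inj]
  apply intervalIntegral.integral_congr_ae
  filter_upwards [_root_.LocallyIntegrable.ae_hasDerivAt_integral hf] with x hx _
  rw [((hx 0).const_add c).deriv]

/-- The primitive started at the left of the support vanishes there, and at the right of the support
it equals the total integral, which is zero. -/
theorem IsTest.exists_primitive {η : ℝ → ℝ} (hη : IsTest η) (h0 : ∫ x, η x = 0) :
    ∃ ζ : ℝ → ℝ, IsTest ζ ∧ _root_.deriv ζ = η := by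
  obtain ⟨R, hR, hz⟩ := hη.exists_support
  let ζ : ℝ → ℝ := fun x => ∫ t in (-R)..x, η t
  have hd : ∀ x, HasDerivAt ζ (η x) x := fun x =>
    intervalIntegral.integral_hasDerivAt_right (hη.continuous.intervalIntegrable _ _)
      hη.continuous.aestronglyMeasurable.stronglyMeasurableAtFilter hη.continuous.continuousAt
  have hd' : _root_.deriv ζ = η := funext fun x => (hd x).deriv
  refine ⟨ζ, ⟨contDiff_infty_iff_deriv.2 ⟨fun x => (hd x).differentiableAt, hd' ▸ hη.smooth⟩, ?_⟩, hd'⟩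
  refine HasCompactSupport.of_support_subset_isCompact (isCompact_Icc (a := -R) (b := R)) ?_
  intro x hx
  by_contra hx'
  apply hx
  rw [Set.mem_Icc, not_and_or] at hx'
  rcases hx' with h | h
  · push Not at h
    show ∫ t in (-R)..x, η t = 0
    rw [intervalIntegral.integral_symm, intervalIntegral.integral_of_le h.le]
    rw [setIntegral_eq_zero_of_forall_eq_zero, neg_zero]
    intro t ht
    exact hz t (by rw [abs_of_neg (by linarith [ht.2])]; linarith [ht.2])
  · push Not at h
    show ∫ t in (-R)..x, η t = 0
    rw [intervalIntegral.integral_of_le (by linarith),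
      setIntegral_eq_integral_of_forall_compl_eq_zero, h0]
    intro t ht
    apply hz
    by_contra hlt
    push Not at hlt
    exact ht ⟨(abs_lt.1 hlt).1, by linarith [(abs_lt.1 hlt).2]⟩

/-- If `A'' = P'` weakly, then `A' = P + κ` weakly for some constant `κ`. -/
theorem exists_isWeakDeriv_add_const {A P : ℝ → ℝ} (hA : LocallyIntegrable A)
    (hP : LocallyIntegrable P)
    (h : ∀ η, IsTest η → ∫ x, A x * deriv (deriv η) x = -∫ x, P x * deriv η x) :
    ∃ κ : ℝ, IsWeakDeriv A (fun x => P x + κ) := by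
  obtain ⟨θ, hθ, hθ1⟩ := exists_isTest_integral_eq_one
  -- This value is forced: it is what testing `A' = P + κ` with `θ` gives, since `∫ θ = 1`. Any
  -- other test function differs from a multiple of `θ` by the derivative of a test function.
  set κ : ℝ := -(∫ x, A x * deriv θ x) - ∫ x, P x * θ x with hκ
  refine ⟨κ, hA, hP.add (locallyIntegrable_const κ), fun ζ h1 h2 => ?_⟩
  have hζ : IsTest ζ := ⟨h1, h2⟩
  set c := ∫ x, ζ x with hc
  have ht := hζ.sub_const_mul hθ c
  obtain ⟨η, hη, hη'⟩ := ht.exists_primitive (by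
    rw [integral_sub hζ.integrable (hθ.integrable.const_mul c), integral_const_mul, hθ1]; simp [hc])
  have := h η hη
  rw [hη'] at this
  have hd : deriv (fun x => ζ x - c * θ x) = fun x => deriv ζ x - c * deriv θ x := by
    funext x
    exact ((hζ.hasDerivAt x).sub ((hθ.hasDerivAt x).const_mul c)).deriv
  rw [hd] at this
  have e1 : ∫ x, A x * (deriv ζ x - c * deriv θ x)
      = (∫ x, A x * deriv ζ x) - c * ∫ x, A x * deriv θ x := by
    rw [← integral_const_mul, ← integral_sub (hζ.deriv.integrable_mul hA)
      ((hθ.deriv.integrable_mul hA).const_mul c)]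
    congr 1; ext x; ring
  have e2 : ∫ x, P x * (ζ x - c * θ x) = (∫ x, P x * ζ x) - c * ∫ x, P x * θ x := by
    rw [← integral_const_mul, ← integral_sub (hζ.integrable_mul hP)
      ((hθ.integrable_mul hP).const_mul c)]
    congr 1; ext x; ring
  have e3 : ∫ x, (P x + κ) * ζ x = (∫ x, P x * ζ x) + κ * c := by
    rw [hc, ← integral_const_mul, ← integral_add (hζ.integrable_mul hP) (hζ.integrable.const_mul κ)]
    congr 1; ext x; ring
  rw [e1, e2] at this
  rw [e3, hκ]
  linarith

/-- du Bois-Reymond lemma. -/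
theorem exists_const_of_integral_mul_deriv_eq_zero {h : ℝ → ℝ} (hh : LocallyIntegrable h)
    (h0 : ∀ η, IsTest η → ∫ x, h x * deriv η x = 0) : ∃ c : ℝ, ∀ᵐ x, h x = c := by
  obtain ⟨θ, hθ, hθ1⟩ := exists_isTest_integral_eq_one
  refine ⟨∫ x, h x * θ x, ?_⟩
  set c := ∫ x, h x * θ x with hc
  refine ae_eq_of_integral_contDiff_smul_eq hh (locallyIntegrable_const c) fun ζ h1 h2 => ?_
  have hζ : IsTest ζ := ⟨h1, h2⟩
  set d := ∫ x, ζ x with hd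
  have ht := hζ.sub_const_mul hθ d
  obtain ⟨η, hη, hη'⟩ := ht.exists_primitive (by
    rw [integral_sub hζ.integrable (hθ.integrable.const_mul d), integral_const_mul, hθ1]; simp [hd])
  have := h0 η hη
  rw [hη'] at this
  have e1 : ∫ x, h x * (ζ x - d * θ x) = (∫ x, h x * ζ x) - d * c := by
    rw [hc, ← integral_const_mul, ← integral_sub (hζ.integrable_mul hh)
      ((hθ.integrable_mul hh).const_mul d)]
    congr 1; ext x; ring
  simp only [smul_eq_mul, integral_mul_const, ← hd]
  rw [e1] at this
  simp only [mul_comm (ζ _)]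
  linarith

namespace IsWeakDeriv

variable {f f' g g' : ℝ → ℝ}

theorem integral_mul_deriv (h : IsWeakDeriv f f') {η : ℝ → ℝ} (hη : IsTest η) :
    ∫ x, f x * deriv η x = -∫ x, f' x * η x := h.2.2 η hη.smooth hη.compact

/-- The difference of `f` and the primitive of `f'` has weak derivative zero, so it is constant by
du Bois-Reymond. This is the source of all continuous representatives below. -/
theorem exists_primitive (h : IsWeakDeriv f f') :
    ∃ c : ℝ, ∀ᵐ x, f x = c + ∫ t in (0 : ℝ)..x, f' t := by
  have hp := isWeakDeriv_primitive h.2.1 0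
  obtain ⟨c, hc⟩ := exists_const_of_integral_mul_deriv_eq_zero
    (h := fun x => f x - (0 + ∫ t in (0 : ℝ)..x, f' t)) (h.1.sub hp.1) (fun η hη => by
      simp_rw [sub_mul]
      rw [integral_sub (hη.deriv.integrable_mul h.1) (hη.deriv.integrable_mul hp.1),
        h.integral_mul_deriv hη, hp.integral_mul_deriv hη, sub_self])
  refine ⟨c, ?_⟩
  filter_upwards [hc] with x hx
  linarith

theorem unique (h : IsWeakDeriv f f') (h' : IsWeakDeriv f g') : f' =ᵐ[volume] g' := by
  refine ae_eq_of_integral_contDiff_smul_eq h.2.1 h'.2.1 fun ζ h1 h2 => ?_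
  have e1 := h.2.2 ζ h1 h2
  have e2 := h'.2.2 ζ h1 h2
  simp only [smul_eq_mul, mul_comm (ζ _)]
  linarith

theorem congr (h : IsWeakDeriv f f') (hf : f =ᵐ[volume] g) (hf' : f' =ᵐ[volume] g') :
    IsWeakDeriv g g' := by
  refine ⟨h.1.congr hf, h.2.1.congr hf', fun ζ h1 h2 => ?_⟩
  have e1 := h.2.2 ζ h1 h2
  rw [integral_congr_ae (g := fun x => g x * deriv ζ x) (by filter_upwards [hf] with x hx; rw [hx]),
    integral_congr_ae (f := fun x => f' x * ζ x) (g := fun x => g' x * ζ x)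
      (by filter_upwards [hf'] with x hx; rw [hx])] at e1
  exact e1

theorem weakDeriv (h : IsWeakDeriv f f') : IsWeakDeriv f (weakDeriv f) := by
  have hex : ∃ f', IsWeakDeriv f f' := ⟨f', h⟩
  rw [RTMHD.weakDeriv, dif_pos hex]
  exact hex.choose_spec

theorem weakDeriv_ae_eq (h : IsWeakDeriv f f') : RTMHD.weakDeriv f =ᵐ[volume] f' :=
  h.weakDeriv.unique h

theorem add (h : IsWeakDeriv f f') (h' : IsWeakDeriv g g') :
    IsWeakDeriv (fun x => f x + g x) (fun x => f' x + g' x) := by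
  refine ⟨h.1.add h'.1, h.2.1.add h'.2.1, fun ζ h1 h2 => ?_⟩
  have hζ : IsTest ζ := ⟨h1, h2⟩
  simp_rw [add_mul]
  rw [integral_add (hζ.deriv.integrable_mul h.1) (hζ.deriv.integrable_mul h'.1),
    integral_add (hζ.integrable_mul h.2.1) (hζ.integrable_mul h'.2.1),
    h.integral_mul_deriv hζ, h'.integral_mul_deriv hζ]
  ring

/-- Leibniz rule for the product of a smooth and a weakly differentiable function. -/
theorem smooth_mul {p : ℝ → ℝ} (hp : ContDiff ℝ ∞ p) (h : IsWeakDeriv f f') :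
    IsWeakDeriv (fun x => p x * f x) (fun x => deriv p x * f x + p x * f' x) := by
  have hp' : ContDiff ℝ ∞ (deriv p) := (contDiff_infty_iff_deriv.1 hp).2
  have l : ∀ {q k : ℝ → ℝ}, Continuous q → LocallyIntegrable k →
      LocallyIntegrable (fun x => q x * k x) := fun hq hk => by
    rw [← locallyIntegrableOn_univ] at hk ⊢
    exact hk.continuousOn_smul isClosed_univ.isLocallyClosed hq.continuousOn
  refine ⟨l hp.continuous h.1, (l hp'.continuous h.1).add (l hp.continuous h.2.1), fun ζ h1 h2 => ?_⟩
  have hζ : IsTest ζ := ⟨h1, h2⟩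
  have e := h.integral_mul_deriv (hζ.mul_left hp)
  have hd : deriv (fun x => p x * ζ x) = fun x => deriv p x * ζ x + p x * deriv ζ x := by
    funext x
    exact ((hp.differentiable (by simp) x).hasDerivAt.mul (hζ.hasDerivAt x)).deriv
  rw [hd] at e
  have i1 := hζ.deriv.mul_left hp |>.integrable_mul h.1
  have i2 := hζ.mul_left hp' |>.integrable_mul h.1
  have i3 := hζ.mul_left hp |>.integrable_mul h.2.1
  have e1 : ∫ x, f x * (deriv p x * ζ x + p x * deriv ζ x)
      = (∫ x, f x * (deriv p x * ζ x)) + ∫ x, f x * (p x * deriv ζ x) := by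
    rw [← integral_add i2 i1]; congr 1; ext x; ring
  have e2 : ∫ x, (deriv p x * f x + p x * f' x) * ζ x
      = (∫ x, f x * (deriv p x * ζ x)) + ∫ x, f' x * (p x * ζ x) := by
    rw [← integral_add i2 i3]; congr 1; ext x; ring
  have e3 : ∫ x, p x * f x * deriv ζ x = ∫ x, f x * (p x * deriv ζ x) := by
    congr 1; ext x; ring
  rw [e2, e3]
  linarith

end IsWeakDeriv

theorem isWeakDeriv_of_hasDerivAt {f f' : ℝ → ℝ} (h : ∀ x, HasDerivAt f (f' x) x)
    (hf' : Continuous f') : IsWeakDeriv f f' := by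
  have hp := isWeakDeriv_primitive hf'.locallyIntegrable (f 0)
  refine hp.congr (ae_of_all _ fun x => ?_) (ae_eq_refl _)
  beta_reduce
  rw [intervalIntegral.integral_eq_sub_of_hasDerivAt (fun x _ => h x) (hf'.intervalIntegrable _ _)]
  ring

/-! ### Multipliers and the spaces `H^k` -/

/-- A multiplier of all spaces `H^k`: smooth and bounded, with compactly supported derivative. -/
structure IsMultiplier (p : ℝ → ℝ) : Prop where
  smooth : ContDiff ℝ ∞ p
  bounded : ∃ C : ℝ, ∀ x, |p x| ≤ C
  compact_deriv : HasCompactSupport (deriv p)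

theorem IsTest.isMultiplier {η : ℝ → ℝ} (hη : IsTest η) : IsMultiplier η :=
  ⟨hη.smooth, by simpa using hη.compact.exists_bound_of_continuous hη.continuous, hη.compact.deriv⟩

theorem IsMultiplier.isTest_deriv {p : ℝ → ℝ} (hp : IsMultiplier p) : IsTest (_root_.deriv p) :=
  ⟨(contDiff_infty_iff_deriv.1 hp.smooth).2, hp.compact_deriv⟩

theorem isMultiplier_const (c : ℝ) : IsMultiplier (fun _ => c) :=
  ⟨contDiff_const, ⟨|c|, fun _ => le_rfl⟩, by
    simp only [deriv_const']; exact HasCompactSupport.zero⟩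

theorem IsMultiplier.mul_memLp {p f : ℝ → ℝ} (hp : IsMultiplier p) (hf : MemLp f 2 volume) :
    MemLp (fun x => p x * f x) 2 volume := by
  obtain ⟨C, hC⟩ := hp.bounded
  refine (hf.const_mul C).mono (hp.smooth.continuous.aestronglyMeasurable.mul hf.1)
    (ae_of_all _ fun x => ?_)
  rw [norm_mul, norm_mul]
  gcongr
  exact (hC x).trans (le_abs_self C)

theorem MemH.of_succ {k : ℕ} : ∀ {f : ℝ → ℝ}, MemH (k + 1) f → MemH k f := by
  induction k with
  | zero => exact fun h => h.1
  | succ k ih => exact fun ⟨h, f', h1, h2⟩ => ⟨h, f', h1, ih h2⟩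

theorem MemH.add {k : ℕ} : ∀ {f g : ℝ → ℝ}, MemH k f → MemH k g → MemH k (fun x => f x + g x) := by
  induction k with
  | zero => exact fun hf hg => MemLp.add hf hg
  | succ k ih =>
    rintro f g ⟨hf, f', hf1, hf2⟩ ⟨hg, g', hg1, hg2⟩
    exact ⟨hf.add hg, _, hf1.add hg1, ih hf2 hg2⟩

/-- Induction through the Leibniz rule, with `p` varying: the derivative of a multiplier is a test
function, hence again a multiplier. -/
theorem IsMultiplier.memH_mul {k : ℕ} : ∀ {p f : ℝ → ℝ}, IsMultiplier p → MemH k f →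
    MemH k (fun x => p x * f x) := by
  induction k with
  | zero => exact fun hp hf => hp.mul_memLp hf
  | succ k ih =>
    rintro p f hp ⟨hf, f', hf1, hf2⟩
    exact ⟨hp.mul_memLp hf, _, hf1.smooth_mul hp.smooth,
      (ih hp.isTest_deriv.isMultiplier (MemH.of_succ ⟨hf, f', hf1, hf2⟩)).add (ih hp hf2)⟩

theorem MemH.const_mul {k : ℕ} {f : ℝ → ℝ} (c : ℝ) (hf : MemH k f) : MemH k (fun x => c * f x) :=
  (isMultiplier_const c).memH_mul hf

/-- A continuously differentiable `f ∈ L²` with `f' ∈ L²` vanishes at infinity. -/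
theorem tendsto_zero_of_memLp_deriv {f f' : ℝ → ℝ} (h : ∀ x, HasDerivAt f (f' x) x)
    (hf : MemLp f 2 volume) (hf' : MemLp f' 2 volume) :
    Tendsto f atBot (𝓝 0) ∧ Tendsto f atTop (𝓝 0) := by
  -- Both `f²` and its derivative are integrable, which forces `f²` to tend to zero.
  have h2 : ∀ x, HasDerivAt (fun x => f x ^ 2) (2 * (f x * f' x)) x := fun x => by
    simpa [mul_assoc] using (h x).fun_pow 2
  have i1 : Integrable fun x => f x ^ 2 := hf.integrable_sq
  have i2 : Integrable fun x => 2 * (f x * f' x) := (hf.integrable_mul hf').const_mul 2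
  have key : ∀ l : Filter ℝ, Tendsto (fun x => f x ^ 2) l (𝓝 0) → Tendsto f l (𝓝 0) := by
    intro l hl
    have := (Real.continuous_sqrt.tendsto 0).comp hl
    rw [Real.sqrt_zero] at this
    rw [tendsto_zero_iff_abs_tendsto_zero]
    refine this.congr fun x => ?_
    simp [Real.sqrt_sq_eq_abs]
  exact ⟨key _ (tendsto_zero_of_hasDerivAt_of_integrableOn_Iic (a := 0) (fun x _ => h2 x)
      i2.integrableOn i1.integrableOn),
    key _ (tendsto_zero_of_hasDerivAt_of_integrableOn_Ioi (a := 0) (fun x _ => h2 x)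
      i2.integrableOn i1.integrableOn)⟩

/-! ### The critical parameter of a quadratic pencil with a compact negative part -/

section Abstract

variable {V : Type*} [NormedAddCommGroup V] [NormedSpace ℝ V]

/-- `b` is sequentially compact: bounded sequences have `b`-Cauchy subsequences. -/
def IsCompactForm (b : V →L[ℝ] V →L[ℝ] ℝ) : Prop :=
  ∀ x : ℕ → V, (∀ n, ‖x n‖ ≤ 1) → ∃ φ : ℕ → ℕ, StrictMono φ ∧
    ∀ ε > 0, ∃ N, ∀ m ≥ N, ∀ n ≥ N, b (x (φ m) - x (φ n)) (x (φ m) - x (φ n)) < ε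

/-- The quadratic pencil `s² j + s e + c - b`. -/
def pencil (j e c b : V →L[ℝ] V →L[ℝ] ℝ) (s : ℝ) : V →L[ℝ] V →L[ℝ] ℝ :=
  s ^ 2 • j + s • e + c - b

theorem pencil_apply (j e c b : V →L[ℝ] V →L[ℝ] ℝ) (s : ℝ) (x y : V) :
    pencil j e c b s x y = s ^ 2 * j x y + s * e x y + c x y - b x y := by
  simp [pencil]

theorem pencil_symm {j e c b : V →L[ℝ] V →L[ℝ] ℝ} (hj : ∀ x y, j x y = j y x)
    (he : ∀ x y, e x y = e y x) (hc : ∀ x y, c x y = c y x) (hb : ∀ x y, b x y = b y x)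
    (s : ℝ) (x y : V) : pencil j e c b s x y = pencil j e c b s y x := by
  rw [pencil_apply, pencil_apply, hj, he, hc, hb]

theorem form_le (q : V →L[ℝ] V →L[ℝ] ℝ) (x : V) : q x x ≤ ‖q‖ * ‖x‖ ^ 2 := by
  have := (le_abs_self _).trans (q.le_opNorm₂ x x)
  rw [sq, ← mul_assoc]; exact this

/-- A zero of a nonnegative symmetric form lies in its kernel. -/
theorem form_eq_zero_of_apply_self_eq_zero {q : V →L[ℝ] V →L[ℝ] ℝ} (hsymm : ∀ x y, q x y = q y x)
    (hq : ∀ x, 0 ≤ q x x) {u : V} (hu : q u u = 0) (η : V) : q u η = 0 := by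
  by_contra hne
  have h : ∀ t : ℝ, 0 ≤ 2 * t * q u η + t ^ 2 * q η η := fun t => by
    have := hq (u + t • η)
    simp [hu, hsymm η u] at this
    linarith
  have hη := hq η
  -- Up to the added `1`, which excludes a zero denominator, this is the minimizer of the parabola
  -- in `t`.
  have h1 := h (-(q u η) / (q η η + 1))
  have hpos : 0 < q η η + 1 := by linarith
  have h2 : 2 * (-(q u η) / (q η η + 1)) * q u η + (-(q u η) / (q η η + 1)) ^ 2 * q η η
      = -(q u η) ^ 2 * (q η η + 2) / (q η η + 1) ^ 2 := by
    field_simp; ring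
  rw [h2] at h1
  have h3 : 0 < (q u η) ^ 2 := by positivity
  have : -(q u η) ^ 2 * (q η η + 2) / (q η η + 1) ^ 2 < 0 :=
    div_neg_of_neg_of_pos (by nlinarith) (by positivity)
  linarith

/-- If `c - b` is negative somewhere, the pencil `s² j + s e + c - b` is, for some `s > 0`,
nonnegative and degenerate. -/
theorem exists_critical_parameter [CompleteSpace V] {j e c b : V →L[ℝ] V →L[ℝ] ℝ}
    (hj : ∀ x, 0 ≤ j x x) (he : ∀ x, 0 ≤ e x x) (hc : ∀ x, 0 ≤ c x x)
    {δ : ℝ} (hδ : 0 < δ) (hcoer : ∀ x, δ * ‖x‖ ^ 2 ≤ j x x + e x x)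
    {K : ℝ} (hb : ∀ x, b x x ≤ K * j x x) (hcomp : IsCompactForm b)
    {u₀ : V} (hu₀ : c u₀ u₀ < b u₀ u₀) :
    ∃ s > 0, (∀ x, 0 ≤ pencil j e c b s x x) ∧
      ∃ u, u ≠ 0 ∧ pencil j e c b s u u = 0 := by
  set q := pencil j e c b with hqdef
  have hq : ∀ s x, q s x x = s ^ 2 * j x x + s * e x x + c x x - b x x := fun s x =>
    pencil_apply j e c b s x x
  have hcont : ∀ x, Continuous fun s => q s x x := fun x => by
    simp_rw [hq]; fun_prop
  let T : Set ℝ := {s | 0 < s ∧ ∃ x, q s x x < 0}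
  have hTne : T.Nonempty := by
    have h0 : q 0 u₀ u₀ < 0 := by rw [hq]; simp; linarith
    have hev : ∀ᶠ s in 𝓝[>] (0 : ℝ), q s u₀ u₀ < 0 :=
      ((hcont u₀).continuousAt.eventually_lt continuousAt_const h0).filter_mono nhdsWithin_le_nhds
    obtain ⟨s, hs1, hs2⟩ := (hev.and self_mem_nhdsWithin).exists
    exact ⟨s, hs2, u₀, hs1⟩
  have hTb : BddAbove T := by
    -- Beyond this bound `s² ≥ K`, so `s² j` absorbs `b`.
    refine ⟨|K| + 1, ?_⟩
    rintro s ⟨hs, x, hx⟩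
    rw [hq] at hx
    by_contra hlt
    push Not at hlt
    have h1 := hb x
    have h2 := hj x
    have h3 := mul_nonneg hs.le (he x)
    have h4 := hc x
    have h5 : K ≤ s ^ 2 := by nlinarith [le_abs_self K, abs_nonneg K]
    nlinarith
  set l := sSup T with hl
  have hlpos : 0 < l := by
    obtain ⟨s, hs⟩ := hTne
    exact hs.1.trans_le (le_csSup hTb hs)
  have hnn : ∀ x, 0 ≤ q l x x := by
    intro x
    by_contra hneg
    push Not at hneg
    have hev : ∀ᶠ s in 𝓝[>] l, q s x x < 0 :=
      ((hcont x).continuousAt.eventually_lt continuousAt_const hneg).filter_mono nhdsWithin_le_nhds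
    obtain ⟨s, hs1, hs2⟩ := (hev.and self_mem_nhdsWithin).exists
    have : s ≤ l := le_csSup hTb ⟨hlpos.trans hs2, x, hs1⟩
    exact absurd hs2 (not_lt.2 this)
  refine ⟨l, hlpos, hnn, ?_⟩
  obtain ⟨s, -, hs2, hsT⟩ := exists_seq_tendsto_sSup hTne hTb
  have hex : ∀ n, ∃ x, ‖x‖ = 1 ∧ q (s n) x x < 0 := by
    intro n
    obtain ⟨hs0, x, hx⟩ := hsT n
    have hx0 : x ≠ 0 := by
      rintro rfl
      simp at hx
    refine ⟨‖x‖⁻¹ • x, norm_smul_inv_norm hx0, ?_⟩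
    simp only [map_smul, _root_.smul_apply, smul_eq_mul]
    have : 0 < ‖x‖⁻¹ := by positivity
    exact mul_neg_of_pos_of_neg this (mul_neg_of_pos_of_neg this hx)
  choose x hx1 hxq using hex
  have hqx : Tendsto (fun n => q l (x n) (x n)) atTop (𝓝 0) := by
    -- `q (s n)` is negative at the unit vector `x n`, and passing from `s n` to `l` changes only
    -- the bounded `j` and `e` terms.
    have hub : ∀ n, q l (x n) (x n) ≤ |l ^ 2 - s n ^ 2| * ‖j‖ + |l - s n| * ‖e‖ := by
      intro n
      have h1 := hxq n
      have h2 := form_le j (x n)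
      have h3 := form_le e (x n)
      rw [hx1 n] at h2 h3
      have h4 := hj (x n)
      have h5 := he (x n)
      rw [hq] at h1 ⊢
      have h6 : (l ^ 2 - s n ^ 2) * j (x n) (x n) ≤ |l ^ 2 - s n ^ 2| * ‖j‖ :=
        mul_le_mul (le_abs_self _) (by linarith) h4 (abs_nonneg _)
      have h7 : (l - s n) * e (x n) (x n) ≤ |l - s n| * ‖e‖ :=
        mul_le_mul (le_abs_self _) (by linarith) h5 (abs_nonneg _)
      linarith
    refine squeeze_zero (fun n => hnn _) hub ?_
    have : Tendsto (fun n => |l ^ 2 - s n ^ 2| * ‖j‖ + |l - s n| * ‖e‖) atTop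
        (𝓝 (|l ^ 2 - l ^ 2| * ‖j‖ + |l - l| * ‖e‖)) :=
      (((tendsto_const_nhds.sub (hs2.pow 2)).abs).mul_const _).add
        (((tendsto_const_nhds.sub hs2).abs).mul_const _)
    simpa using this
  obtain ⟨φ, hφ, hφb⟩ := hcomp x (fun n => (hx1 n).le)
  set γ := min (l ^ 2) l * δ with hγ
  have hγpos : 0 < γ := by positivity
  have hlow : ∀ y, γ * ‖y‖ ^ 2 ≤ q l y y + b y y := by
    intro y
    rw [hq]
    have h1 : min (l ^ 2) l * j y y ≤ l ^ 2 * j y y :=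
      mul_le_mul_of_nonneg_right (min_le_left _ _) (hj y)
    have h2 : min (l ^ 2) l * e y y ≤ l * e y y :=
      mul_le_mul_of_nonneg_right (min_le_right _ _) (he y)
    have h3 : min (l ^ 2) l * (δ * ‖y‖ ^ 2) ≤ min (l ^ 2) l * (j y y + e y y) :=
      mul_le_mul_of_nonneg_left (hcoer y) (by positivity)
    have h4 := hc y
    rw [hγ]
    linarith
  -- Parallelogram law, with the nonnegative term at `y + z` dropped.
  have hpar : ∀ y z, q l (y - z) (y - z) ≤ 2 * q l y y + 2 * q l z z := by
    intro y z
    have := hnn (y + z)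
    simp only [map_add, map_sub, _root_.add_apply, _root_.sub_apply] at this ⊢
    linarith
  have hcau : CauchySeq (fun n => x (φ n)) := by
    rw [Metric.cauchySeq_iff]
    intro ε hε
    -- Five small quantities are added: twice `q l` at each of the two vectors, and `b` at their
    -- difference.
    have hε' : 0 < γ * ε ^ 2 / 5 := by positivity
    obtain ⟨N₁, hN₁⟩ := hφb _ hε'
    obtain ⟨N₂, hN₂⟩ := eventually_atTop.1
      ((hqx.comp hφ.tendsto_atTop).eventually_lt_const hε')
    refine ⟨max N₁ N₂, fun m hm n hn => ?_⟩
    have hb' := hN₁ m (le_of_max_le_left hm) n (le_of_max_le_left hn)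
    have hm' := hN₂ m (le_of_max_le_right hm)
    have hn' := hN₂ n (le_of_max_le_right hn)
    simp only [Function.comp] at hm' hn'
    have h1 := hlow (x (φ m) - x (φ n))
    have h2 := hpar (x (φ m)) (x (φ n))
    have h3 : γ * ‖x (φ m) - x (φ n)‖ ^ 2 < γ * ε ^ 2 := by linarith
    rw [dist_eq_norm]
    exact lt_of_pow_lt_pow_left₀ 2 hε.le (lt_of_mul_lt_mul_left h3 hγpos.le)
  obtain ⟨u, hu⟩ := cauchySeq_tendsto_of_complete hcau
  refine ⟨u, ?_, ?_⟩
  · have : ‖u‖ = 1 := tendsto_nhds_unique hu.norm (by simp [hx1])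
    rintro rfl
    simp at this
  · have h1 : Tendsto (fun n => q l (x (φ n)) (x (φ n))) atTop (𝓝 (q l u u)) := by
      have hc2 : Continuous fun y => q l y y := by fun_prop
      exact (hc2.tendsto u).comp hu
    exact tendsto_nhds_unique h1 (hqx.comp hφ.tendsto_atTop)

/-- Degenerate directions of the critical pencil can be normalized by `j` and lie in its kernel. -/
theorem exists_critical_parameter_normalized [CompleteSpace V] {j e c b : V →L[ℝ] V →L[ℝ] ℝ}
    (hjs : ∀ x y, j x y = j y x) (hes : ∀ x y, e x y = e y x) (hcs : ∀ x y, c x y = c y x)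
    (hbs : ∀ x y, b x y = b y x)
    (hj : ∀ x, 0 ≤ j x x) (he : ∀ x, 0 ≤ e x x) (hc : ∀ x, 0 ≤ c x x)
    {δ : ℝ} (hδ : 0 < δ) (hcoer : ∀ x, δ * ‖x‖ ^ 2 ≤ j x x + e x x)
    {K : ℝ} (hb : ∀ x, b x x ≤ K * j x x) (hcomp : IsCompactForm b)
    {u₀ : V} (hu₀ : c u₀ u₀ < b u₀ u₀) :
    ∃ s > 0, (∀ x, 0 ≤ pencil j e c b s x x) ∧
      ∃ u, j u u = 1 ∧ ∀ y, pencil j e c b s u y = 0 := by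
  obtain ⟨s, hs, hnn, u, hu, hu0⟩ := exists_critical_parameter hj he hc hδ hcoer hb hcomp hu₀
  refine ⟨s, hs, hnn, ?_⟩
  have hker := form_eq_zero_of_apply_self_eq_zero (pencil_symm hjs hes hcs hbs s) hnn hu0
  have hJpos : 0 < j u u := by
    -- If `j` vanished at `u`, then `b ≤ K j` would make `b` nonpositive there, the null condition
    -- would force `e` to vanish, and coercivity would give `u = 0`.
    refine lt_of_le_of_ne (hj u) fun h0 => hu ?_
    have h1 := hb u
    rw [pencil_apply, ← h0] at hu0
    rw [← h0, mul_zero] at h1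
    have h2 := hc u
    have h3 := he u
    have h4 : s * e u u ≤ 0 := by linarith
    have h5 : e u u = 0 := by nlinarith
    have h6 := hcoer u
    rw [← h0, h5] at h6
    have h7 : ‖u‖ ^ 2 ≤ 0 := by nlinarith
    exact norm_eq_zero.1 (pow_eq_zero_iff two_ne_zero |>.1 (le_antisymm h7 (sq_nonneg _)))
  refine ⟨(√(j u u))⁻¹ • u, ?_, fun y => ?_⟩
  · simp only [map_smul, _root_.smul_apply, smul_eq_mul]
    rw [← mul_assoc, ← mul_inv, Real.mul_self_sqrt hJpos.le, inv_mul_cancel₀ hJpos.ne']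
  · simp [hker y]

end Abstract

/-! ### Weighted forms on `L²` and the space `H²` -/

/-- The Hilbert space `L²(ℝ)`. -/
abbrev L2 := Lp ℝ 2 (volume : Measure ℝ)

theorem L2.locallyIntegrable (f : L2) : LocallyIntegrable f volume :=
  (Lp.memLp f).locallyIntegrable (by norm_num)

theorem L2.integrable_mul (f g : L2) : Integrable (fun x => f x * g x) volume :=
  (Lp.memLp f).integrable_mul (Lp.memLp g)

theorem L2.inner_eq (f g : L2) : ⟪f, g⟫ = ∫ x, f x * g x := by
  rw [L2.inner_def]
  simp [mul_comm]

theorem L2.inner_toLp {h : ℝ → ℝ} (f : L2) (hh : MemLp h 2 volume) :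
    ⟪f, hh.toLp h⟫ = ∫ x, f x * h x := by
  rw [L2.inner_eq]
  refine integral_congr_ae ?_
  filter_upwards [hh.coeFn_toLp] with x hx
  rw [hx]

/-- Multiplication by a multiplier, as an operator on `L²`. -/
def mulOp {m : ℝ → ℝ} (hm : IsMultiplier m) : L2 →ₗ[ℝ] L2 where
  toFun f := (hm.mul_memLp (Lp.memLp f)).toLp _
  map_add' f g := by
    rw [← MemLp.toLp_add, MemLp.toLp_eq_toLp_iff]
    filter_upwards [Lp.coeFn_add f g] with x hx
    rw [hx]
    simp [mul_add]
  map_smul' c f := by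
    rw [RingHom.id_apply, ← MemLp.toLp_const_smul, MemLp.toLp_eq_toLp_iff]
    filter_upwards [Lp.coeFn_smul c f] with x hx
    rw [hx]
    simp [mul_left_comm]

theorem exists_norm_mulOp_le {m : ℝ → ℝ} (hm : IsMultiplier m) :
    ∃ C : ℝ, ∀ f, ‖mulOp hm f‖ ≤ C * ‖f‖ := by
  obtain ⟨C, hC⟩ := hm.bounded
  refine ⟨C, fun f => Lp.norm_le_mul_norm_of_ae_le_mul ?_⟩
  filter_upwards [(hm.mul_memLp (Lp.memLp f)).coeFn_toLp] with x hx
  show ‖((hm.mul_memLp (Lp.memLp f)).toLp _ : ℝ → ℝ) x‖ ≤ _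
  rw [hx, norm_mul]
  exact mul_le_mul_of_nonneg_right (hC x) (norm_nonneg _)

/-- The bilinear form `(f, g) ↦ ∫ m f g` on `L²`. -/
def mulForm {m : ℝ → ℝ} (hm : IsMultiplier m) : L2 →L[ℝ] L2 →L[ℝ] ℝ :=
  LinearMap.mkContinuous₂ ((innerₗ L2).comp (mulOp hm)) (exists_norm_mulOp_le hm).choose
    fun f _ => (norm_inner_le_norm _ _).trans
      (mul_le_mul_of_nonneg_right ((exists_norm_mulOp_le hm).choose_spec f) (norm_nonneg _))

theorem mulForm_apply {m : ℝ → ℝ} (hm : IsMultiplier m) (f g : L2) :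
    mulForm hm f g = ∫ x, m x * f x * g x := by
  have : mulForm hm f g = ⟪mulOp hm f, g⟫ := rfl
  rw [this, L2.inner_eq]
  refine integral_congr_ae ?_
  filter_upwards [(hm.mul_memLp (Lp.memLp f)).coeFn_toLp] with x hx
  show ((hm.mul_memLp (Lp.memLp f)).toLp _ : ℝ → ℝ) x * _ = _
  rw [hx]

theorem mulForm_symm {m : ℝ → ℝ} (hm : IsMultiplier m) (f g : L2) :
    mulForm hm f g = mulForm hm g f := by
  rw [mulForm_apply, mulForm_apply]
  congr 1; ext x; ring

theorem integrable_multiplier_mul_mul {m f g : ℝ → ℝ} (hm : IsMultiplier m) (hf : MemLp f 2 volume)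
    (hg : MemLp g 2 volume) : Integrable (fun x => m x * f x * g x) :=
  (hm.mul_memLp hf).integrable_mul hg

theorem mulForm_mono {m m' : ℝ → ℝ} (hm : IsMultiplier m) (hm' : IsMultiplier m')
    (h : ∀ x, m x ≤ m' x) (f : L2) : mulForm hm f f ≤ mulForm hm' f f := by
  rw [mulForm_apply, mulForm_apply]
  refine integral_mono (integrable_multiplier_mul_mul hm (Lp.memLp f) (Lp.memLp f))
    (integrable_multiplier_mul_mul hm' (Lp.memLp f) (Lp.memLp f)) fun x => ?_
  simp only [mul_assoc]
  exact mul_le_mul_of_nonneg_right (h x) (mul_self_nonneg _)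

theorem mulForm_const (c : ℝ) (f g : L2) : mulForm (isMultiplier_const c) f g = c * ⟪f, g⟫ := by
  rw [mulForm_apply, L2.inner_eq, ← integral_const_mul]
  simp only [mul_assoc]

/-- Test functions as elements of `L²`. -/
def IsTest.toL2 {η : ℝ → ℝ} (hη : IsTest η) : L2 := (hη.memLp 2).toLp η

/-- Expresses weak differentiability by linear conditions continuous in `(f, g)`. Linearity and
closedness of the graph, hence completeness of `H²`, follow at once. -/
theorem isWeakDeriv_iff_inner (f g : L2) :
    IsWeakDeriv f g ↔ ∀ η (hη : IsTest η), ⟪f, hη.deriv.toL2⟫ + ⟪g, hη.toL2⟫ = 0 := by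
  simp only [IsTest.toL2, L2.inner_toLp]
  constructor
  · intro h η hη
    rw [h.integral_mul_deriv hη]; ring
  · intro h
    refine ⟨L2.locallyIntegrable f, L2.locallyIntegrable g, fun η h1 h2 => ?_⟩
    have := h η ⟨h1, h2⟩
    linarith

/-- The graph of the weak derivative in `L² × L²`. -/
def weakGraph : Submodule ℝ (L2 × L2) where
  carrier := {p | IsWeakDeriv p.1 p.2}
  add_mem' {p q} hp hq := by
    simp only [Set.mem_ofPred_eq, isWeakDeriv_iff_inner] at *
    intro η hη
    have h1 := hp η hη
    have h2 := hq η hη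
    simp only [Prod.fst_add, Prod.snd_add, inner_add_left]
    linarith
  zero_mem' := by
    simp only [Set.mem_ofPred_eq, isWeakDeriv_iff_inner]
    simp
  smul_mem' c p hp := by
    simp only [Set.mem_ofPred_eq, isWeakDeriv_iff_inner] at *
    intro η hη
    have h1 := hp η hη
    simp only [Prod.smul_fst, Prod.smul_snd, inner_smul_left]
    rw [← mul_add, h1, mul_zero]

theorem mem_weakGraph {p : L2 × L2} : p ∈ weakGraph ↔ IsWeakDeriv p.1 p.2 := Iff.rfl

theorem isClosed_weakGraph : IsClosed (weakGraph : Set (L2 × L2)) := by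
  have : (weakGraph : Set (L2 × L2)) =
      ⋂ (η : ℝ → ℝ) (hη : IsTest η), {p | ⟪p.1, hη.deriv.toL2⟫ + ⟪p.2, hη.toL2⟫ = 0} := by
    ext p
    simp only [SetLike.mem_coe, mem_weakGraph, isWeakDeriv_iff_inner, Set.mem_iInter,
      Set.mem_ofPred_eq]
  rw [this]
  refine isClosed_iInter fun η => isClosed_iInter fun hη => isClosed_eq ?_ continuous_const
  fun_prop

/-- The Sobolev space `H²(ℝ)` as the space of triples `(u, u', u'')` in `L² × L² × L²`. -/
def sobolevTwo : Submodule ℝ (L2 × L2 × L2) :=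
  weakGraph.comap ((LinearMap.fst ℝ L2 (L2 × L2)).prod
      (LinearMap.fst ℝ L2 L2 ∘ₗ LinearMap.snd ℝ L2 (L2 × L2))) ⊓
    weakGraph.comap (LinearMap.snd ℝ L2 (L2 × L2))

theorem mem_sobolevTwo {x : L2 × L2 × L2} :
    x ∈ sobolevTwo ↔ IsWeakDeriv x.1 x.2.1 ∧ IsWeakDeriv x.2.1 x.2.2 := Iff.rfl

theorem isClosed_sobolevTwo : IsClosed (sobolevTwo : Set (L2 × L2 × L2)) := by
  have h1 : Continuous fun x : L2 × L2 × L2 => (x.1, x.2.1) := by fun_prop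
  exact (isClosed_weakGraph.preimage h1).inter (isClosed_weakGraph.preimage continuous_snd)

instance : CompleteSpace sobolevTwo := isClosed_sobolevTwo.completeSpace_coe

/-! ### Hölder representatives and Rellich compactness -/

theorem abs_setIntegral_le (g : L2) {a b : ℝ} (hab : a ≤ b) :
    |∫ t in a..b, g t| ≤ √(b - a) * ‖g‖ := by
  have h := L2.inner_indicatorConstLp_one (𝕜 := ℝ) (μ := volume) (measurableSet_Ioc (a := a) (b := b))
    (by simp) g
  rw [intervalIntegral.integral_of_le hab, ← h]
  refine (abs_real_inner_le_norm _ _).trans ?_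
  gcongr
  rw [norm_indicatorConstLp (by norm_num) (by norm_num)]
  simp [Real.sqrt_eq_rpow, Real.volume_real_Ioc_of_le hab]

/-- The Hölder continuous representative of an element of the unit ball of `H¹`. -/
theorem exists_holder_representative {f g : L2} (h : IsWeakDeriv f g) (hf : ‖f‖ ≤ 1)
    (hg : ‖g‖ ≤ 1) : ∃ u : ℝ → ℝ, f =ᵐ[volume] u ∧
      (∀ x y, |u x - u y| ≤ √|x - y|) ∧ ∀ x, |u x| ≤ 2 + √|x| := by
  obtain ⟨c, hc⟩ := h.exists_primitive
  have hii : ∀ a b, IntervalIntegrable g volume a b := fun a b =>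
    ((L2.locallyIntegrable g).integrableOn_isCompact isCompact_uIcc).intervalIntegrable
  set u : ℝ → ℝ := fun x => c + ∫ t in (0 : ℝ)..x, g t with hu
  have hdiff : ∀ x y, u y - u x = ∫ t in x..y, g t := fun x y => by
    rw [← intervalIntegral.integral_interval_sub_left (hii 0 y) (hii 0 x)]
    simp [hu]
  have hle : ∀ x y, x ≤ y → |u y - u x| ≤ √(y - x) := fun x y hxy => by
    rw [hdiff]
    refine (abs_setIntegral_le g hxy).trans ?_
    exact mul_le_of_le_one_right (Real.sqrt_nonneg _) hg
  have hH : ∀ x y, |u x - u y| ≤ √|x - y| := fun x y => by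
    rcases le_total x y with hxy | hxy
    · rw [abs_sub_comm, abs_sub_comm x y, abs_of_nonneg (sub_nonneg.2 hxy)]
      exact hle x y hxy
    · rw [abs_of_nonneg (sub_nonneg.2 hxy)]
      exact hle y x hxy
  have hcont : Continuous u :=
    continuous_const.add (intervalIntegral.continuous_primitive hii 0)
  have hsq : ∫ x, u x ^ 2 ≤ 1 := by
    have : ∫ x, u x ^ 2 = ⟪f, f⟫ := by
      rw [L2.inner_eq]
      refine integral_congr_ae ?_
      filter_upwards [hc] with x hx
      rw [hx, sq]
    rw [this, real_inner_self_eq_norm_sq]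
    exact pow_le_one₀ (norm_nonneg _) hf
  have hint : Integrable fun x => u x ^ 2 := by
    have := (Lp.memLp f).integrable_sq
    refine this.congr ?_
    filter_upwards [hc] with x hx
    rw [hx]
  have h0 : |u 0| ≤ 2 := by
    -- On `[0, 1]` the Hölder bound gives `|u 0 - u y| ≤ 1`. Averaging over this interval turns the
    -- `L²` bound into a bound at `0`.
    have h1 : ∫ y in (0 : ℝ)..1, (u 0 ^ 2) ≤ ∫ y in (0 : ℝ)..1, (2 * u y ^ 2 + 2) := by
      refine intervalIntegral.integral_mono_on zero_le_one (by simp)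
        ((by fun_prop : Continuous fun y => 2 * u y ^ 2 + 2).intervalIntegrable _ _) fun y hy => ?_
      have h2 := hH 0 y
      have h3 : √|0 - y| ≤ 1 := by
        rw [Real.sqrt_le_one]
        rw [zero_sub, abs_neg, abs_of_nonneg hy.1]; exact hy.2
      have h4 : (u 0 - u y) ^ 2 ≤ 1 := by
        rw [sq_le_one_iff_abs_le_one]; linarith
      nlinarith [sq_nonneg (u 0 - 2 * u y)]
    have h5 : ∫ y in (0 : ℝ)..1, u y ^ 2 ≤ 1 := by
      rw [intervalIntegral.integral_of_le zero_le_one]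
      exact (setIntegral_le_integral hint (ae_of_all _ fun x => sq_nonneg _)).trans hsq
    rw [intervalIntegral.integral_add
      ((by fun_prop : Continuous fun y => 2 * u y ^ 2).intervalIntegrable _ _)
      (by simp), intervalIntegral.integral_const_mul] at h1
    simp at h1
    rw [← Real.sqrt_sq_eq_abs]
    exact Real.sqrt_le_iff.2 ⟨by norm_num, by linarith⟩
  refine ⟨u, hc, hH, fun x => ?_⟩
  have h1 := hH x 0
  rw [sub_zero] at h1
  have h2 := abs_sub_abs_le_abs_sub (u x) (u 0)
  linarith

/-- Rellich compactness: a test weight gives a compact form on `H¹`. -/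
theorem exists_subseq_mulForm_cauchy {m : ℝ → ℝ} (hm : IsTest m) (f g : ℕ → L2)
    (h : ∀ n, IsWeakDeriv (f n) (g n)) (hf : ∀ n, ‖f n‖ ≤ 1) (hg : ∀ n, ‖g n‖ ≤ 1) :
    ∃ φ : ℕ → ℕ, StrictMono φ ∧ ∀ ε > 0, ∃ N, ∀ p ≥ N, ∀ n ≥ N,
      |mulForm hm.isMultiplier (f (φ p) - f (φ n)) (f (φ p) - f (φ n))| < ε := by
  choose u hfu hH hB using fun n => exists_holder_representative (h n) (hf n) (hg n)
  obtain ⟨R, hR, hz⟩ := hm.exists_support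
  have hcont : ∀ n, Continuous (u n) := fun n => by
    rw [Metric.continuous_iff]
    intro y ε hε
    refine ⟨ε ^ 2, by positivity, fun x hx => ?_⟩
    rw [Real.dist_eq] at hx ⊢
    refine (hH n x y).trans_lt ?_
    rw [Real.sqrt_lt' hε]
    exact hx
  let F : ℕ → BoundedContinuousFunction (Set.Icc (-R) R) ℝ := fun n =>
    BoundedContinuousFunction.mkOfCompact ⟨fun x => u n x, (hcont n).comp continuous_subtype_val⟩
  -- Arzelà–Ascoli on an interval containing the support of `m`, with modulus of continuity `√`.
  have hcomp : IsCompact (closure (Set.range F)) := by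
    refine BoundedContinuousFunction.arzela_ascoli (Metric.closedBall 0 (2 + √R))
      (isCompact_closedBall _ _) _ ?_ ?_
    · rintro _ x ⟨n, rfl⟩
      rw [mem_closedBall_zero_iff]
      refine (hB n x).trans ?_
      gcongr
      exact abs_le.2 x.2
    · refine Metric.equicontinuous_of_continuity_modulus Real.sqrt ?_ _ ?_
      · simpa using Real.continuous_sqrt.tendsto 0
      · rintro x y ⟨_, n, rfl⟩
        exact hH n x y
  obtain ⟨a, -, φ, hφ, hlim⟩ := hcomp.tendsto_subseq (fun n => subset_closure (Set.mem_range_self n))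
  refine ⟨φ, hφ, fun ε hε => ?_⟩
  set I := ∫ x, |m x| with hI
  have hI0 : 0 ≤ I := integral_nonneg fun x => abs_nonneg _
  -- The cap `1` gives `d² ≤ d`, and the `+ 1` covers the case `I = 0`.
  set d := min 1 (ε / (I + 1)) with hd
  have hdpos : 0 < d := by positivity
  obtain ⟨N, hN⟩ := Metric.cauchySeq_iff.1 hlim.cauchySeq d hdpos
  refine ⟨N, fun p hp n hn => ?_⟩
  have hdist := hN p hp n hn
  have hpt : ∀ x, |x| ≤ R → |u (φ p) x - u (φ n) x| ≤ d := fun x hx => by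
    have := (BoundedContinuousFunction.dist_coe_le_dist (f := F (φ p)) (g := F (φ n))
      ⟨x, abs_le.1 hx⟩).trans hdist.le
    exact this
  rw [mulForm_apply]
  have hb : ∀ᵐ x, ‖m x * (f (φ p) - f (φ n) : L2) x * (f (φ p) - f (φ n) : L2) x‖ ≤ |m x| * d ^ 2 := by
    filter_upwards [Lp.coeFn_sub (f (φ p)) (f (φ n)), hfu (φ p), hfu (φ n)] with x h1 h2 h3
    rw [h1, Pi.sub_apply, h2, h3, norm_mul, norm_mul, Real.norm_eq_abs,
      Real.norm_eq_abs, mul_assoc, ← sq]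
    by_cases hx : |x| ≤ R
    · gcongr
      exact hpt x hx
    · rw [hz x (not_le.1 hx).le]; simp
  have := norm_integral_le_of_norm_le ((hm.integrable.abs).mul_const (d ^ 2)) hb
  rw [integral_mul_const, ← hI] at this
  refine lt_of_le_of_lt this ?_
  have h1 : d ^ 2 ≤ d := by
    have := min_le_left 1 (ε / (I + 1))
    nlinarith
  have h2 : d ≤ ε / (I + 1) := min_le_right _ _
  calc I * d ^ 2 ≤ I * (ε / (I + 1)) := by gcongr; linarith
    _ < ε := by
      rw [mul_div_assoc', div_lt_iff₀ (by positivity)]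
      nlinarith

theorem IsTest.isWeakDeriv {η : ℝ → ℝ} (hη : IsTest η) : IsWeakDeriv η (_root_.deriv η) :=
  isWeakDeriv_of_hasDerivAt hη.hasDerivAt hη.deriv.continuous

theorem IsTest.coeFn_toL2 {η : ℝ → ℝ} (hη : IsTest η) : hη.toL2 =ᵐ[volume] η :=
  (hη.memLp 2).coeFn_toLp

theorem IsTest.isWeakDeriv_toL2 {η : ℝ → ℝ} (hη : IsTest η) : IsWeakDeriv hη.toL2 hη.deriv.toL2 :=
  hη.isWeakDeriv.congr hη.coeFn_toL2.symm hη.deriv.coeFn_toL2.symm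

/-- Test functions as elements of `H²`. -/
def IsTest.toSobolevTwo {η : ℝ → ℝ} (hη : IsTest η) : sobolevTwo :=
  ⟨(hη.toL2, hη.deriv.toL2, hη.deriv.deriv.toL2), hη.isWeakDeriv_toL2, hη.deriv.isWeakDeriv_toL2⟩

/-! ### Density of `H²` in `H¹` -/

/-- The pairs `(u, u')` with `u ∈ H²`, as a subspace of the Hilbert space `L² ⊕ L²`. -/
def sobolevTwoPairs : Submodule ℝ (WithLp 2 (L2 × L2)) :=
  (sobolevTwo.map ((LinearMap.fst ℝ L2 (L2 × L2)).prod
      (LinearMap.fst ℝ L2 L2 ∘ₗ LinearMap.snd ℝ L2 (L2 × L2)))).comap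
    (WithLp.linearEquiv 2 ℝ (L2 × L2)).toLinearMap

theorem mem_sobolevTwoPairs {p : WithLp 2 (L2 × L2)} :
    p ∈ sobolevTwoPairs ↔ ∃ x ∈ sobolevTwo, x.1 = p.fst ∧ x.2.1 = p.snd := by
  constructor
  · rintro ⟨x, hx, h⟩
    exact ⟨x, hx, congrArg Prod.fst h, congrArg Prod.snd h⟩
  · rintro ⟨x, hx, h1, h2⟩
    exact ⟨x, hx, Prod.ext h1 h2⟩

/-- `H²` is dense in `H¹`. -/
theorem mem_closure_sobolevTwoPairs {p : WithLp 2 (L2 × L2)} (hp : IsWeakDeriv p.fst p.snd) :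
    p ∈ closure (sobolevTwoPairs : Set (WithLp 2 (L2 × L2))) := by
  set K := sobolevTwoPairs.topologicalClosure with hK
  have : CompleteSpace K := (Submodule.isClosed_topologicalClosure _).completeSpace_coe
  have hG : ∀ q ∈ K, IsWeakDeriv q.fst q.snd := by
    have hcl : IsClosed {q : WithLp 2 (L2 × L2) | (q.fst, q.snd) ∈ weakGraph} :=
      isClosed_weakGraph.preimage
        (by exact (WithLp.prod_continuous_ofLp 2 L2 L2) :
          Continuous fun q : WithLp 2 (L2 × L2) => (q.fst, q.snd))
    intro q hq
    refine closure_minimal ?_ hcl hq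
    intro r hr
    obtain ⟨x, hx, h1, h2⟩ := mem_sobolevTwoPairs.1 hr
    show IsWeakDeriv r.fst r.snd
    rw [← h1, ← h2]
    exact (mem_sobolevTwo.1 hx).1
  set y := p - K.orthogonalProjectionOnto p with hy
  have hyK : y ∈ Kᗮ := K.sub_starProjection_mem_orthogonal p
  have hyG : IsWeakDeriv y.fst y.snd := by
    have h1 : (p.fst, p.snd) ∈ weakGraph := hp
    have h2 : ((K.orthogonalProjectionOnto p : WithLp 2 (L2 × L2)).fst,
      (K.orthogonalProjectionOnto p : WithLp 2 (L2 × L2)).snd) ∈ weakGraph :=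
        hG _ (K.orthogonalProjectionOnto p).2
    exact weakGraph.sub_mem h1 h2
  -- Orthogonality of `y = (f, f')` to every test pair `(η, η')` says weakly that `f'' = f`. Hence
  -- `f ∈ H²`, and `y` lies both in `K` and in its orthogonal complement.
  have hyG' : IsWeakDeriv y.snd y.fst := by
    rw [isWeakDeriv_iff_inner]
    intro η hη
    have hmem : WithLp.toLp 2 (hη.toL2, hη.deriv.toL2) ∈ K := by
      refine Submodule.le_topologicalClosure _ (mem_sobolevTwoPairs.2 ?_)
      exact ⟨hη.toSobolevTwo, hη.toSobolevTwo.2, rfl, rfl⟩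
    have := Submodule.inner_left_of_mem_orthogonal hmem hyK
    rw [WithLp.prod_inner_apply] at this
    rw [add_comm]
    exact this
  have hyK' : y ∈ K := by
    refine Submodule.le_topologicalClosure _ (mem_sobolevTwoPairs.2 ?_)
    exact ⟨(y.fst, y.snd, y.fst), ⟨hyG, hyG'⟩, rfl, rfl⟩
  have hy0 : y = 0 := by
    have := Submodule.inner_right_of_mem_orthogonal hyK' hyK
    exact inner_self_eq_zero.1 this
  have : p = K.orthogonalProjectionOnto p := sub_eq_zero.1 hy0
  rw [this]
  exact (K.orthogonalProjectionOnto p).2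

/-- A strict quadratic inequality satisfied by some `H¹` function is satisfied by some `H²` one. -/
theorem exists_sobolevTwo_lt {m : ℝ → ℝ} (hm : IsMultiplier m) {A B κ : ℝ} {f g : L2}
    (h : IsWeakDeriv f g) (hlt : A * ‖f‖ ^ 2 + B * ‖g‖ ^ 2 < κ * mulForm hm f f) :
    ∃ x : sobolevTwo, A * ‖x.1.1‖ ^ 2 + B * ‖x.1.2.1‖ ^ 2 < κ * mulForm hm x.1.1 x.1.1 := by
  have hopen : IsOpen {q : WithLp 2 (L2 × L2) |
      A * ‖q.fst‖ ^ 2 + B * ‖q.snd‖ ^ 2 < κ * mulForm hm q.fst q.fst} := by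
    have h1 : Continuous fun q : WithLp 2 (L2 × L2) => q.fst :=
      continuous_fst.comp (WithLp.prod_continuous_ofLp 2 L2 L2)
    have h2 : Continuous fun q : WithLp 2 (L2 × L2) => q.snd :=
      continuous_snd.comp (WithLp.prod_continuous_ofLp 2 L2 L2)
    exact isOpen_lt (by fun_prop) (by fun_prop)
  have hmem := mem_closure_sobolevTwoPairs (p := WithLp.toLp 2 (f, g)) h
  obtain ⟨q, hq1, hq2⟩ := mem_closure_iff.1 hmem _ hopen hlt
  obtain ⟨x, hx, e1, e2⟩ := mem_sobolevTwoPairs.1 hq2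
  refine ⟨⟨x, hx⟩, ?_⟩
  show A * ‖x.1‖ ^ 2 + B * ‖x.2.1‖ ^ 2 < κ * mulForm hm x.1 x.1
  rw [e1, e2]
  exact hq1

/-! ### Passage between functions and elements of the Sobolev spaces -/

theorem MemH.exists_pair {ψ : ℝ → ℝ} (h : MemH 1 ψ) :
    ∃ f g : L2, IsWeakDeriv f g ∧ f =ᵐ[volume] ψ ∧ g =ᵐ[volume] weakDeriv ψ := by
  obtain ⟨h0, ψ', h1, h2⟩ := h
  have h2' : MemLp ψ' 2 volume := h2
  refine ⟨h0.toLp ψ, h2'.toLp ψ', h1.congr h0.coeFn_toLp.symm h2'.coeFn_toLp.symm,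
    h0.coeFn_toLp, h2'.coeFn_toLp.trans h1.weakDeriv_ae_eq.symm⟩

theorem MemH.exists_sobolevTwo {ψ : ℝ → ℝ} (h : MemH 2 ψ) :
    ∃ x : sobolevTwo, x.1.1 =ᵐ[volume] ψ := by
  obtain ⟨h0, ψ', h1, h2, ψ'', h3, h4⟩ := h
  have h4' : MemLp ψ'' 2 volume := h4
  exact ⟨⟨(h0.toLp ψ, h2.toLp ψ', h4'.toLp ψ''), h1.congr h0.coeFn_toLp.symm h2.coeFn_toLp.symm,
    h3.congr h2.coeFn_toLp.symm h4'.coeFn_toLp.symm⟩, h0.coeFn_toLp⟩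

section Representative

variable {x : sobolevTwo} {ψ : ℝ → ℝ}

theorem memH_two_of_ae_eq (h : x.1.1 =ᵐ[volume] ψ) : MemH 2 ψ :=
  ⟨(memLp_congr_ae h).1 (Lp.memLp _), x.1.2.1, x.2.1.congr h (ae_eq_refl _), Lp.memLp _, x.1.2.2,
    x.2.2, Lp.memLp _⟩

theorem weakDeriv_ae_eq_of_ae_eq (h : x.1.1 =ᵐ[volume] ψ) : x.1.2.1 =ᵐ[volume] weakDeriv ψ :=
  (x.2.1.congr h (ae_eq_refl _)).weakDeriv_ae_eq.symm

theorem weakDeriv_weakDeriv_ae_eq_of_ae_eq (h : x.1.1 =ᵐ[volume] ψ) :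
    x.1.2.2 =ᵐ[volume] weakDeriv (weakDeriv ψ) :=
  (x.2.2.congr (weakDeriv_ae_eq_of_ae_eq h) (ae_eq_refl _)).weakDeriv_ae_eq.symm

end Representative

theorem norm_sq_eq_integral {f : L2} {ψ : ℝ → ℝ} (h : f =ᵐ[volume] ψ) :
    ‖f‖ ^ 2 = ∫ x, ψ x ^ 2 := by
  rw [← real_inner_self_eq_norm_sq, L2.inner_eq]
  refine integral_congr_ae ?_
  filter_upwards [h] with x hx
  rw [hx, sq]

theorem mulForm_eq_integral {m : ℝ → ℝ} (hm : IsMultiplier m) {f : L2} {ψ : ℝ → ℝ}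
    (h : f =ᵐ[volume] ψ) : mulForm hm f f = ∫ x, m x * ψ x ^ 2 := by
  rw [mulForm_apply]
  refine integral_congr_ae ?_
  filter_upwards [h] with x hx
  rw [hx]; ring

/-- The essential bound holds on a set that is dense, being of full measure, and closed by
continuity; so it holds everywhere. -/
theorem IsRTProfile.isMultiplier {ρ : ℝ → ℝ} (hρ : IsRTProfile ρ) : IsMultiplier ρ := by
  refine ⟨hρ.smooth, ?_, hρ.compact_deriv⟩
  have hfin : eLpNormEssSup ρ volume < ⊤ := by
    have := hρ.bounded.2
    rwa [eLpNorm_exponent_top] at this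
  set C := (eLpNormEssSup ρ volume).toReal with hC
  have hae : ∀ᵐ x, ‖ρ x‖ ≤ C := by
    filter_upwards [ae_le_eLpNormEssSup (f := ρ) (μ := volume)] with x hx
    rw [← toReal_enorm]
    exact ENNReal.toReal_mono hfin.ne hx
  refine ⟨C, fun x => ?_⟩
  have hd : Dense {x | ‖ρ x‖ ≤ C} := Measure.dense_of_ae hae
  have hcl : IsClosed {x | ‖ρ x‖ ≤ C} := isClosed_le hρ.smooth.continuous.norm continuous_const
  have := hcl.closure_eq ▸ hd.closure_eq
  have hx : x ∈ {x | ‖ρ x‖ ≤ C} := this ▸ Set.mem_univ x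
  exact hx

theorem IsRTProfile.isTest_deriv {ρ : ℝ → ℝ} (hρ : IsRTProfile ρ) : IsTest (deriv ρ) :=
  hρ.isMultiplier.isTest_deriv

/-! ### The energies as bilinear forms on `H²` -/

/-- Coefficient of `ψ²` in the magnetic energy. -/
def magCoeff₀ (M : ℝ) (ξ : Freq) : FieldDir → ℝ
  | .horizontal => M ^ 2 * ξ 0 ^ 2 * ‖ξ‖ ^ 2
  | .vertical => 0

/-- Coefficient of `|ψ'|²` in the magnetic energy. -/
def magCoeff₁ (M : ℝ) (ξ : Freq) : FieldDir → ℝ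
  | .horizontal => M ^ 2 * ξ 0 ^ 2
  | .vertical => M ^ 2 * ‖ξ‖ ^ 2

/-- Coefficient of `|ψ''|²` in the magnetic energy. -/
def magCoeff₂ (M : ℝ) : FieldDir → ℝ
  | .horizontal => 0
  | .vertical => M ^ 2

theorem magCoeff₀_nonneg (M : ℝ) (ξ : Freq) (dir : FieldDir) : 0 ≤ magCoeff₀ M ξ dir := by
  cases dir <;> simp only [magCoeff₀] <;> positivity

theorem magCoeff₁_nonneg (M : ℝ) (ξ : Freq) (dir : FieldDir) : 0 ≤ magCoeff₁ M ξ dir := by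
  cases dir <;> simp only [magCoeff₁] <;> positivity

theorem magCoeff₂_nonneg (M : ℝ) (dir : FieldDir) : 0 ≤ magCoeff₂ M dir := by
  cases dir <;> simp only [magCoeff₂] <;> positivity

/-- The function component of `H²`. -/
def proj₀ : sobolevTwo →L[ℝ] L2 := (ContinuousLinearMap.fst ℝ L2 (L2 × L2)).comp sobolevTwo.subtypeL

/-- The first derivative on `H²`. -/
def proj₁ : sobolevTwo →L[ℝ] L2 :=
  ((ContinuousLinearMap.fst ℝ L2 L2).comp (ContinuousLinearMap.snd ℝ L2 (L2 × L2))).comp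
    sobolevTwo.subtypeL

/-- The second derivative on `H²`. -/
def proj₂ : sobolevTwo →L[ℝ] L2 :=
  ((ContinuousLinearMap.snd ℝ L2 L2).comp (ContinuousLinearMap.snd ℝ L2 (L2 × L2))).comp
    sobolevTwo.subtypeL

/-- The inner product of `L²` as a continuous bilinear form. -/
def innerForm : L2 →L[ℝ] L2 →L[ℝ] ℝ := mulForm (isMultiplier_const 1)

theorem innerForm_apply (f g : L2) : innerForm f g = ⟪f, g⟫ := by
  rw [innerForm, mulForm_const, one_mul]

/-- The bilinear form of `J`. -/
def formJ {ρ : ℝ → ℝ} (hρ : IsMultiplier ρ) (k : ℝ) : sobolevTwo →L[ℝ] sobolevTwo →L[ℝ] ℝ :=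
  k • (mulForm hρ).bilinearComp proj₀ proj₀ + (mulForm hρ).bilinearComp proj₁ proj₁

/-- The bilinear form of the viscous energy. -/
def formE (μ k : ℝ) : sobolevTwo →L[ℝ] sobolevTwo →L[ℝ] ℝ :=
  μ • ((4 * k) • innerForm.bilinearComp proj₁ proj₁ +
    innerForm.bilinearComp (k • proj₀ + proj₂) (k • proj₀ + proj₂))

/-- The bilinear form of the magnetic energy. -/
def formC (c₀ c₁ c₂ : ℝ) : sobolevTwo →L[ℝ] sobolevTwo →L[ℝ] ℝ :=
  c₀ • innerForm.bilinearComp proj₀ proj₀ + c₁ • innerForm.bilinearComp proj₁ proj₁ +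
    c₂ • innerForm.bilinearComp proj₂ proj₂

/-- The bilinear form of the gravitational energy. -/
def formB {m : ℝ → ℝ} (hm : IsMultiplier m) (κ : ℝ) : sobolevTwo →L[ℝ] sobolevTwo →L[ℝ] ℝ :=
  κ • (mulForm hm).bilinearComp proj₀ proj₀

section FormApply

variable {m : ℝ → ℝ} (hm : IsMultiplier m) (μ k κ c₀ c₁ c₂ : ℝ) (x y : sobolevTwo)

theorem formJ_apply : formJ hm k x y =
    k * mulForm hm x.1.1 y.1.1 + mulForm hm x.1.2.1 y.1.2.1 := rfl

theorem formE_apply : formE μ k x y = μ * (4 * k * ⟪x.1.2.1, y.1.2.1⟫ +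
    ⟪k • x.1.1 + x.1.2.2, k • y.1.1 + y.1.2.2⟫) := by
  rw [← innerForm_apply, ← innerForm_apply]; rfl

theorem formC_apply : formC c₀ c₁ c₂ x y =
    c₀ * ⟪x.1.1, y.1.1⟫ + c₁ * ⟪x.1.2.1, y.1.2.1⟫ + c₂ * ⟪x.1.2.2, y.1.2.2⟫ := by
  rw [← innerForm_apply, ← innerForm_apply, ← innerForm_apply]; rfl

theorem formB_apply : formB hm κ x y = κ * mulForm hm x.1.1 y.1.1 := rfl

end FormApply

theorem isCompactForm_formB {m : ℝ → ℝ} (hm : IsTest m) {κ : ℝ} (hκ : 0 < κ) :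
    IsCompactForm (formB hm.isMultiplier κ) := by
  intro x hx
  obtain ⟨φ, hφ, h⟩ := exists_subseq_mulForm_cauchy hm (fun n => (x n).1.1) (fun n => (x n).1.2.1)
    (fun n => (x n).2.1) (fun n => (norm_fst_le _).trans (hx n))
    (fun n => ((norm_fst_le _).trans (norm_snd_le (x n).1)).trans (hx n))
  refine ⟨φ, hφ, fun ε hε => ?_⟩
  obtain ⟨N, hN⟩ := h (ε / κ) (by positivity)
  refine ⟨N, fun p hp n hn => ?_⟩
  have := (le_abs_self _).trans_lt (hN p hp n hn)
  rw [formB_apply]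
  rw [lt_div_iff₀ hκ, mul_comm] at this
  exact this

section Energy

variable {ρ : ℝ → ℝ} (hρ : IsMultiplier ρ) {x : sobolevTwo} {ψ : ℝ → ℝ}

theorem J_eq_formJ (h : x.1.1 =ᵐ[volume] ψ) (ξ : Freq) : J ρ ξ ψ = formJ hρ (‖ξ‖ ^ 2) x x := by
  rw [formJ_apply, mulForm_apply, mulForm_apply, J, ← integral_const_mul,
    ← integral_add ((integrable_multiplier_mul_mul hρ (Lp.memLp _) (Lp.memLp _)).const_mul _)
      (integrable_multiplier_mul_mul hρ (Lp.memLp _) (Lp.memLp _))]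
  refine integral_congr_ae ?_
  filter_upwards [h, weakDeriv_ae_eq_of_ae_eq h] with t h0 h1
  rw [← h0, ← h1]
  ring

theorem E₁_eq_formE (h : x.1.1 =ᵐ[volume] ψ) (μ : ℝ) (ξ : Freq) :
    E₁ μ ξ ψ = formE μ (‖ξ‖ ^ 2) x x := by
  rw [formE_apply, E₁, L2.inner_eq, L2.inner_eq, ← integral_const_mul (4 * ‖ξ‖ ^ 2), ← integral_add
    ((L2.integrable_mul x.1.2.1 _).const_mul _)
    (L2.integrable_mul (‖ξ‖ ^ 2 • x.1.1 + x.1.2.2) _)]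
  congr 1
  refine integral_congr_ae ?_
  filter_upwards [h, weakDeriv_ae_eq_of_ae_eq h, weakDeriv_weakDeriv_ae_eq_of_ae_eq h,
    Lp.coeFn_add (‖ξ‖ ^ 2 • x.1.1) x.1.2.2, Lp.coeFn_smul (‖ξ‖ ^ 2) x.1.1] with t h0 h1 h2 h3 h4
  rw [h3, Pi.add_apply, h4, Pi.smul_apply, ← h0, ← h1, ← h2, smul_eq_mul]
  ring

/-- The factor `|ξ|²` clears the denominator in `E₀`, so that both field directions become instances
of one form with three nonnegative coefficients. -/
theorem E₀_eq_forms (h : x.1.1 =ᵐ[volume] ψ) (g M : ℝ) {ξ : Freq} (hξ : ξ ≠ 0) (dir : FieldDir) :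
    ‖ξ‖ ^ 2 * E₀ g M ρ ξ dir ψ =
      formC (magCoeff₀ M ξ dir) (magCoeff₁ M ξ dir) (magCoeff₂ M dir) x x
        - formB hρ.isTest_deriv.isMultiplier (g * ‖ξ‖ ^ 2) x x := by
  have hk : ‖ξ‖ ≠ 0 := norm_ne_zero_iff.2 hξ
  have i0 := L2.integrable_mul x.1.1 x.1.1
  have i1 := L2.integrable_mul x.1.2.1 x.1.2.1
  have i2 := L2.integrable_mul x.1.2.2 x.1.2.2
  have i3 := integrable_multiplier_mul_mul hρ.isTest_deriv.isMultiplier (Lp.memLp x.1.1)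
    (Lp.memLp x.1.1)
  rw [formC_apply, formB_apply, mulForm_apply, L2.inner_eq, L2.inner_eq, L2.inner_eq,
    ← integral_const_mul, ← integral_const_mul, ← integral_const_mul, ← integral_const_mul,
    ← integral_add (i0.const_mul _) (i1.const_mul _),
    ← integral_add ((i0.const_mul _).fun_add (i1.const_mul _)) (i2.const_mul _),
    ← integral_sub (((i0.const_mul _).fun_add (i1.const_mul _)).fun_add (i2.const_mul _)) (i3.const_mul _)]
  cases dir
  all_goals
    simp only [E₀, magCoeff₀, magCoeff₁, magCoeff₂]
    rw [← integral_const_mul]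
    refine integral_congr_ae ?_
    filter_upwards [h, weakDeriv_ae_eq_of_ae_eq h, weakDeriv_weakDeriv_ae_eq_of_ae_eq h]
      with t h0 h1 h2
    rw [← h0, ← h1]
    try rw [← h2]
    field_simp
    ring

theorem E_eq_forms (h : x.1.1 =ᵐ[volume] ψ) 
    (g μ M : ℝ) {ξ : Freq} (hξ : ξ ≠ 0) (dir : FieldDir) (s : ℝ) :
    E g μ M ρ dir ξ s ψ = s * formE μ (‖ξ‖ ^ 2) x x +
      formC (magCoeff₀ M ξ dir) (magCoeff₁ M ξ dir) (magCoeff₂ M dir) x x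
        - formB hρ.isTest_deriv.isMultiplier (g * ‖ξ‖ ^ 2) x x := by
  rw [E, E₀_eq_forms hρ h g M hξ dir, E₁_eq_formE h]
  ring

end Energy

/-! ### Coercivity, bounds and existence of the growth rate -/

theorem formC_apply_self (c₀ c₁ c₂ : ℝ) (x : sobolevTwo) :
    formC c₀ c₁ c₂ x x = c₀ * ‖x.1.1‖ ^ 2 + c₁ * ‖x.1.2.1‖ ^ 2 + c₂ * ‖x.1.2.2‖ ^ 2 := by
  rw [formC_apply, real_inner_self_eq_norm_sq, real_inner_self_eq_norm_sq,
    real_inner_self_eq_norm_sq]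

theorem formE_apply_self (μ k : ℝ) (x : sobolevTwo) :
    formE μ k x x = μ * (4 * k * ‖x.1.2.1‖ ^ 2 + ‖k • x.1.1 + x.1.2.2‖ ^ 2) := by
  rw [formE_apply, real_inner_self_eq_norm_sq, real_inner_self_eq_norm_sq]

theorem le_mulForm {m : ℝ → ℝ} (hm : IsMultiplier m) {c : ℝ} (hc : ∀ x, c ≤ m x) (f : L2) :
    c * ‖f‖ ^ 2 ≤ mulForm hm f f := by
  rw [← real_inner_self_eq_norm_sq, ← mulForm_const]
  exact mulForm_mono _ _ hc f

theorem mulForm_le {m : ℝ → ℝ} (hm : IsMultiplier m) {c : ℝ} (hc : ∀ x, m x ≤ c) (f : L2) :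
    mulForm hm f f ≤ c * ‖f‖ ^ 2 := by
  rw [← real_inner_self_eq_norm_sq, ← mulForm_const]
  exact mulForm_mono _ _ hc f

/-- `J` controls `ψ` and `ψ'` because `ρ̄` is bounded below, and `ψ''` is recovered from the viscous
term `kψ + ψ''` at the cost of `kψ`. -/
theorem norm_sq_le_formJ_add_formE {ρ : ℝ → ℝ} (hρ : IsMultiplier ρ) {c μ k : ℝ} (hc : 0 < c)
    (hcρ : ∀ x, c ≤ ρ x) (hμ : 0 < μ) (hk : 0 < k) :
    ∃ δ > 0, ∀ x, δ * ‖x‖ ^ 2 ≤ formJ hρ k x x + formE μ k x x := by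
  -- The three summands are the costs of `(1 + 2k²)‖u‖²`, `‖v‖²` and `2‖z‖²`, where `z = k • u + w`.
  set D := (1 + 2 * k ^ 2) / (c * k) + 1 / c + 2 / μ with hD
  have hDpos : 0 < D := by positivity
  refine ⟨D⁻¹, by positivity, fun x => ?_⟩
  rw [inv_mul_le_iff₀ hDpos, formJ_apply, formE_apply_self]
  set u := x.1.1
  set v := x.1.2.1
  set w := x.1.2.2
  set z := k • u + w
  have hju : c * ‖u‖ ^ 2 ≤ mulForm hρ u u := le_mulForm hρ hcρ u
  have hjv : c * ‖v‖ ^ 2 ≤ mulForm hρ v v := le_mulForm hρ hcρ v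
  have hw : ‖w‖ ^ 2 ≤ 2 * ‖z‖ ^ 2 + 2 * k ^ 2 * ‖u‖ ^ 2 := by
    have h1 : w = z - k • u := by simp [z]
    have h2 : ‖w‖ ≤ ‖z‖ + k * ‖u‖ := by
      rw [h1]
      refine (norm_sub_le _ _).trans ?_
      rw [norm_smul, Real.norm_of_nonneg hk.le]
    have h3 : ‖w‖ ^ 2 ≤ (‖z‖ + k * ‖u‖) ^ 2 := by gcongr
    nlinarith [sq_nonneg (‖z‖ - k * ‖u‖)]
  have hx : ‖x‖ ^ 2 ≤ ‖u‖ ^ 2 + ‖v‖ ^ 2 + ‖w‖ ^ 2 := by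
    have h1 : ‖x‖ = max ‖u‖ (max ‖v‖ ‖w‖) := rfl
    rw [h1]
    have := sq_nonneg ‖u‖
    have := sq_nonneg ‖v‖
    have := sq_nonneg ‖w‖
    rcases max_choice ‖u‖ (max ‖v‖ ‖w‖) with h | h <;> rw [h]
    · linarith
    · rcases max_choice ‖v‖ ‖w‖ with h | h <;> rw [h] <;> linarith
  set P := k * mulForm hρ u u + mulForm hρ v v + μ * (4 * k * ‖v‖ ^ 2 + ‖z‖ ^ 2) with hP
  have p1 : 0 ≤ k * (c * ‖u‖ ^ 2) := by positivity
  have p1' : k * (c * ‖u‖ ^ 2) ≤ k * mulForm hρ u u := by gcongr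
  have p2 : 0 ≤ c * ‖v‖ ^ 2 := by positivity
  have p3 : 0 ≤ μ * (4 * k * ‖v‖ ^ 2) := by positivity
  have p4 : 0 ≤ μ * ‖z‖ ^ 2 := by positivity
  have hPe : P = k * mulForm hρ u u + mulForm hρ v v + (μ * (4 * k * ‖v‖ ^ 2) + μ * ‖z‖ ^ 2) := by
    rw [hP]; ring
  have hU : (1 + 2 * k ^ 2) * ‖u‖ ^ 2 ≤ (1 + 2 * k ^ 2) / (c * k) * P := by
    rw [div_mul_eq_mul_div, le_div_iff₀ (by positivity), mul_assoc]
    gcongr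
    nlinarith
  have hV : ‖v‖ ^ 2 ≤ 1 / c * P := by
    rw [div_mul_eq_mul_div, le_div_iff₀ hc, one_mul]
    nlinarith
  have hZ : 2 * ‖z‖ ^ 2 ≤ 2 / μ * P := by
    rw [div_mul_eq_mul_div, le_div_iff₀ hμ, mul_assoc]
    gcongr
    nlinarith
  have : D * P = (1 + 2 * k ^ 2) / (c * k) * P + 1 / c * P + 2 / μ * P := by rw [hD]; ring
  linarith

theorem formJ_symm {m : ℝ → ℝ} (hm : IsMultiplier m) (k : ℝ) (x y : sobolevTwo) :
    formJ hm k x y = formJ hm k y x := by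
  rw [formJ_apply, formJ_apply, mulForm_symm hm x.1.1, mulForm_symm hm x.1.2.1]

theorem formE_symm (μ k : ℝ) (x y : sobolevTwo) : formE μ k x y = formE μ k y x := by
  rw [formE_apply, formE_apply, real_inner_comm x.1.2.1, real_inner_comm (k • x.1.1 + x.1.2.2)]

theorem formC_symm (c₀ c₁ c₂ : ℝ) (x y : sobolevTwo) :
    formC c₀ c₁ c₂ x y = formC c₀ c₁ c₂ y x := by
  rw [formC_apply, formC_apply, real_inner_comm x.1.1, real_inner_comm x.1.2.1,
    real_inner_comm x.1.2.2]

theorem formB_symm {m : ℝ → ℝ} (hm : IsMultiplier m) (κ : ℝ) (x y : sobolevTwo) :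
    formB hm κ x y = formB hm κ y x := by
  rw [formB_apply, formB_apply, mulForm_symm hm x.1.1]

theorem formJ_nonneg {m : ℝ → ℝ} (hm : IsMultiplier m) {c k : ℝ} (hc : 0 ≤ c) (hcm : ∀ x, c ≤ m x)
    (hk : 0 ≤ k) (x : sobolevTwo) : 0 ≤ formJ hm k x x := by
  rw [formJ_apply]
  have h1 := le_mulForm hm hcm x.1.1
  have h2 := le_mulForm hm hcm x.1.2.1
  have h3 : 0 ≤ c * ‖x.1.1‖ ^ 2 := by positivity
  have h4 : 0 ≤ c * ‖x.1.2.1‖ ^ 2 := by positivity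
  exact add_nonneg (mul_nonneg hk (h3.trans h1)) (h4.trans h2)

theorem formB_le {ρ m : ℝ → ℝ} (hρ : IsMultiplier ρ) (hm : IsMultiplier m) {c C g k : ℝ}
    (hc : 0 < c) (hcρ : ∀ x, c ≤ ρ x) (hC : ∀ x, m x ≤ C) (hC0 : 0 ≤ C) (hg : 0 ≤ g) (hk : 0 ≤ k)
    (x : sobolevTwo) : formB hm (g * k) x x ≤ (g * C / c) * formJ hρ k x x := by
  rw [formB_apply, formJ_apply]
  have h1 := le_mulForm hρ hcρ x.1.1
  have h2 := le_mulForm hρ hcρ x.1.2.1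
  have h4 : 0 ≤ c * ‖x.1.2.1‖ ^ 2 := by positivity
  have h5 := mulForm_le hm hC x.1.1
  calc g * k * mulForm hm x.1.1 x.1.1
      ≤ g * k * (C * ‖x.1.1‖ ^ 2) := by gcongr
    _ = (g * C / c) * (k * (c * ‖x.1.1‖ ^ 2)) := by field_simp
    _ ≤ _ := by
      refine mul_le_mul_of_nonneg_left ?_ (by positivity)
      have := mul_le_mul_of_nonneg_left h1 hk
      linarith

/-- Existence of the growth rate together with a normalized minimizer. -/
theorem exists_growth_parameter {ρ : ℝ → ℝ} (hρ : IsRTProfile ρ) {g μ k c₀ c₁ c₂ : ℝ} (hg : 0 < g)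
    (hμ : 0 < μ) (hk : 0 < k) (h₀ : 0 ≤ c₀) (h₁ : 0 ≤ c₁) (h₂ : 0 ≤ c₂) {x₀ : sobolevTwo}
    (hx₀ : formC c₀ c₁ c₂ x₀ x₀ < formB hρ.isTest_deriv.isMultiplier (g * k) x₀ x₀) :
    ∃ s > 0,
      (∀ x, 0 ≤ pencil (formJ hρ.isMultiplier k) (formE μ k) (formC c₀ c₁ c₂)
        (formB hρ.isTest_deriv.isMultiplier (g * k)) s x x) ∧
      ∃ u, formJ hρ.isMultiplier k u u = 1 ∧
        ∀ y, pencil (formJ hρ.isMultiplier k) (formE μ k) (formC c₀ c₁ c₂)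
          (formB hρ.isTest_deriv.isMultiplier (g * k)) s u y = 0 := by
  obtain ⟨c, hc, hcρ⟩ := hρ.inf_pos
  obtain ⟨C, hC⟩ := hρ.isTest_deriv.isMultiplier.bounded
  have hC0 : 0 ≤ C := (abs_nonneg _).trans (hC 0)
  have hJ := formJ_nonneg hρ.isMultiplier hc.le hcρ hk.le
  obtain ⟨δ, hδ, hcoer⟩ := norm_sq_le_formJ_add_formE hρ.isMultiplier hc hcρ hμ hk
  have hB := formB_le hρ.isMultiplier hρ.isTest_deriv.isMultiplier hc hcρ
    (fun t => (le_abs_self _).trans (hC t)) hC0 hg.le hk.le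
  exact exists_critical_parameter_normalized (formJ_symm _ _) (formE_symm _ _) (formC_symm _ _ _)
    (formB_symm _ _) hJ (fun x => by rw [formE_apply_self]; positivity)
    (fun x => by rw [formC_apply_self]; positivity) hδ hcoer hB
    (isCompactForm_formB hρ.isTest_deriv (by positivity)) hx₀

/-! ### Negative energy directions in the solvable domain -/

/-- A bump supported where `ρ̄' > 0`. It settles the horizontal case `ξ₁ = 0`, where the magnetic
energy vanishes. -/
theorem exists_deriv_weighted_pos {ρ : ℝ → ℝ} (hρ : IsRTProfile ρ) :
    ∃ x : sobolevTwo, 0 < mulForm hρ.isTest_deriv.isMultiplier x.1.1 x.1.1 := by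
  obtain ⟨x₀, hx₀⟩ := hρ.exists_deriv_pos
  have hcont := hρ.isTest_deriv.continuous
  obtain ⟨r, hr, hball⟩ := Metric.eventually_nhds_iff_ball.1
    (hcont.continuousAt.eventually_const_lt hx₀)
  let f : ContDiffBump x₀ := ⟨r / 2, r, by positivity, by linarith⟩
  have hf : IsTest f := ⟨f.contDiff, f.hasCompactSupport⟩
  refine ⟨hf.toSobolevTwo, ?_⟩
  show 0 < mulForm _ hf.toL2 hf.toL2
  rw [mulForm_eq_integral _ hf.coeFn_toL2]
  refine Continuous.integral_pos_of_hasCompactSupport_nonneg_nonzero (x := x₀) ?_ ?_ ?_ ?_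
  · have := hf.continuous
    fun_prop
  · exact (hρ.isTest_deriv.compact).mul_right
  · intro t
    by_cases ht : t ∈ Metric.ball x₀ r
    · exact mul_nonneg (hball t ht).le (sq_nonneg _)
    · have : f t = 0 := f.zero_of_le_dist (not_lt.1 ht)
      simp [this]
  · have : f x₀ = 1 := f.one_of_mem_closedBall (Metric.mem_closedBall_self (by positivity))
    simp [this, hx₀.ne']

/-- In the solvable domain the magnetic energy is dominated, in some direction, by gravity. -/
theorem exists_formC_lt_formB {g M : ℝ} (hg : 0 < g) {ρ : ℝ → ℝ} (hρ : IsRTProfile ρ)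
    (dir : FieldDir) (hM : AdmissibleField g ρ M dir) {ξ : Freq}
    (hξ : ξ ∈ solvableDomain g M ρ dir) :
    ξ ≠ 0 ∧ ∃ x : sobolevTwo,
      formC (magCoeff₀ M ξ dir) (magCoeff₁ M ξ dir) (magCoeff₂ M dir) x x
        < formB hρ.isTest_deriv.isMultiplier (g * ‖ξ‖ ^ 2) x x := by
  have hm := hρ.isTest_deriv.isMultiplier
  cases dir with
  | horizontal =>
    obtain ⟨hξ, hξ0⟩ := hξ
    have hξ0 : ξ ≠ 0 := hξ0
    have hk : 0 < ‖ξ‖ := norm_pos_iff.2 hξ0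
    refine ⟨hξ0, ?_⟩
    rcases hξ with ⟨h1, -, h3⟩ | h
    · have hMξ : M * ξ 0 ≠ 0 := by
        intro h0
        rw [mul_comm (ξ 0), h0] at h1
        simp at h1
      rw [criticalFreqFun, Real.lt_sqrt hk.le] at h3
      set S := {q : ℝ | ∃ ψ : ℝ → ℝ, MemH 1 ψ ∧ ¬ ψ =ᵐ[volume] 0 ∧
        q = (g * ‖ξ‖ ^ 2 * (∫ x, deriv ρ x * ψ x ^ 2) / (M * ξ 0) ^ 2
          - ∫ x, weakDeriv ψ x ^ 2) / ∫ x, ψ x ^ 2} with hS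
      -- The supremum of the empty set is `0` by convention, which would contradict `‖ξ‖² < sSup S`.
      -- Likewise a zero denominator would give the quotient `0`.
      have hne : S.Nonempty := by
        by_contra hemp
        rw [Set.not_nonempty_iff_eq_empty] at hemp
        rw [hemp, Real.sSup_empty] at h3
        nlinarith
      obtain ⟨q, ⟨ψ, hψ, -, rfl⟩, hlt⟩ := exists_lt_of_lt_csSup hne h3
      obtain ⟨u, v, huv, hu, hv⟩ := hψ.exists_pair
      rw [← norm_sq_eq_integral hu, ← norm_sq_eq_integral hv, ← mulForm_eq_integral hm hu] at hlt
      have hupos : 0 < ‖u‖ ^ 2 := by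
        refine lt_of_le_of_ne (sq_nonneg _) fun h0 => ?_
        rw [← h0, div_zero] at hlt
        nlinarith
      rw [lt_div_iff₀ hupos, lt_sub_iff_add_lt, lt_div_iff₀ (by positivity)] at hlt
      obtain ⟨x, hx⟩ := exists_sobolevTwo_lt hm (A := M ^ 2 * ξ 0 ^ 2 * ‖ξ‖ ^ 2)
        (B := M ^ 2 * ξ 0 ^ 2) (κ := g * ‖ξ‖ ^ 2) huv (by linarith)
      refine ⟨x, ?_⟩
      rw [formC_apply_self, formB_apply]
      simpa [magCoeff₀, magCoeff₁, magCoeff₂] using hx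
    · have h : ξ 0 = 0 := h
      obtain ⟨x, hx⟩ := exists_deriv_weighted_pos hρ
      refine ⟨x, ?_⟩
      rw [formC_apply_self, formB_apply]
      simp only [magCoeff₀, magCoeff₁, magCoeff₂, h]
      have : 0 < g * ‖ξ‖ ^ 2 * mulForm hm x.1.1 x.1.1 := by positivity
      simpa using this
  | vertical =>
    have hξ : criticalFreqConst g M ρ < ‖ξ‖ := hξ
    obtain ⟨hM0, hMc⟩ := hM
    have hM0 : M ≠ 0 := abs_pos.1 hM0
    have hk : 0 < ‖ξ‖ := lt_of_le_of_lt (Real.sqrt_nonneg _) hξ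
    refine ⟨norm_pos_iff.1 hk, ?_⟩
    have key : ∀ {x : sobolevTwo} {ψ : ℝ → ℝ}, x.1.1 =ᵐ[volume] ψ →
        ∫ t, (g * deriv ρ t * ψ t ^ 2 - M ^ 2 * weakDeriv ψ t ^ 2) =
          g * mulForm hm x.1.1 x.1.1 - M ^ 2 * ‖x.1.2.1‖ ^ 2 := by
      intro x ψ h
      rw [← real_inner_self_eq_norm_sq, L2.inner_eq, mulForm_apply, ← integral_const_mul,
        ← integral_const_mul, ← integral_sub
          ((integrable_multiplier_mul_mul hm (Lp.memLp _) (Lp.memLp _)).const_mul _)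
          ((L2.integrable_mul _ _).const_mul _)]
      refine integral_congr_ae ?_
      filter_upwards [h, weakDeriv_ae_eq_of_ae_eq h] with t h0 h1
      rw [← h0, ← h1]; ring
    rw [criticalFreqConst, Real.sqrt_lt' hk] at hξ
    set S := {q : ℝ | ∃ ψ : ℝ → ℝ, MemH 2 ψ ∧
      0 < (∫ x, (g * deriv ρ x * ψ x ^ 2 - M ^ 2 * weakDeriv ψ x ^ 2)) ∧
      q = (M ^ 2 * ∫ x, weakDeriv (weakDeriv ψ) x ^ 2) /
          ∫ x, (g * deriv ρ x * ψ x ^ 2 - M ^ 2 * weakDeriv ψ x ^ 2)} with hS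
    -- Here `|M| < M_c` enters: it gives an `H¹` function with positive denominator, which density
    -- replaces by an `H²` one.
    have hne : S.Nonempty := by
      rw [criticalNumber, one_div, ENNReal.lt_rpow_inv_iff two_pos] at hMc
      simp only [lt_iSup_iff] at hMc
      obtain ⟨ψ, ⟨hψ, -⟩, hlt⟩ := hMc
      rw [ENNReal.ofReal_rpow_of_nonneg (abs_nonneg _) two_pos.le, Real.rpow_two, sq_abs,
        ENNReal.ofReal_lt_ofReal_iff_of_nonneg (sq_nonneg _)] at hlt
      obtain ⟨u, v, huv, hu, hv⟩ := hψ.exists_pair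
      have e1 : ∫ x, g * deriv ρ x * ψ x ^ 2 = g * mulForm hm u u := by
        rw [mulForm_eq_integral hm hu, ← integral_const_mul]
        simp only [mul_assoc]
      rw [← norm_sq_eq_integral hv, e1] at hlt
      have hvpos : 0 < ‖v‖ ^ 2 := by
        refine lt_of_le_of_ne (sq_nonneg _) fun h0 => ?_
        rw [← h0, div_zero] at hlt
        nlinarith [sq_nonneg M]
      rw [lt_div_iff₀ hvpos] at hlt
      obtain ⟨x, hx⟩ := exists_sobolevTwo_lt hm (A := 0) (B := M ^ 2) (κ := g) huv (by linarith)
      refine ⟨_, x.1.1, memH_two_of_ae_eq (ae_eq_refl _), ?_, rfl⟩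
      rw [key (ae_eq_refl _)]
      linarith
    obtain ⟨q, ⟨ψ, hψ, hpos, rfl⟩, hlt⟩ := exists_lt_of_csInf_lt hne hξ
    obtain ⟨x, hx⟩ := hψ.exists_sobolevTwo
    refine ⟨x, ?_⟩
    rw [div_lt_iff₀ hpos, key hx, ← norm_sq_eq_integral (weakDeriv_weakDeriv_ae_eq_of_ae_eq hx)] at hlt
    rw [formC_apply_self, formB_apply]
    simp only [magCoeff₀, magCoeff₁, magCoeff₂]
    linarith

/-! ### Regularity of weak solutions -/

theorem IsMultiplier.add {p q : ℝ → ℝ} (hp : IsMultiplier p) (hq : IsMultiplier q) :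
    IsMultiplier (fun x => p x + q x) := by
  obtain ⟨C, hC⟩ := hp.bounded
  obtain ⟨D, hD⟩ := hq.bounded
  refine ⟨hp.smooth.add hq.smooth,
    ⟨C + D, fun x => (abs_add_le _ _).trans (add_le_add (hC x) (hD x))⟩, ?_⟩
  have : deriv (fun x => p x + q x) = fun x => deriv p x + deriv q x := funext fun x =>
    deriv_fun_add (hp.smooth.differentiable (by simp) x) (hq.smooth.differentiable (by simp) x)
  rw [this]
  exact hp.compact_deriv.add hq.compact_deriv

theorem IsMultiplier.const_mul {p : ℝ → ℝ} (hp : IsMultiplier p) (c : ℝ) :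
    IsMultiplier (fun x => c * p x) := by
  obtain ⟨C, hC⟩ := hp.bounded
  refine ⟨contDiff_const.mul hp.smooth, ⟨|c| * C, fun x => ?_⟩, ?_⟩
  · rw [abs_mul]
    exact mul_le_mul_of_nonneg_left (hC x) (abs_nonneg c)
  · have : deriv (fun x => c * p x) = fun x => c * deriv p x := funext fun x =>
      deriv_const_mul c (hp.smooth.differentiable (by simp) x)
    rw [this]
    exact hp.compact_deriv.mul_left (f := fun _ => c)

theorem hasDerivAt_primitive_of_ae_eq {f f' : ℝ → ℝ} (h : f =ᵐ[volume] f') (hf' : Continuous f')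
    (c x : ℝ) : HasDerivAt (fun x => c + ∫ t in (0 : ℝ)..x, f t) (f' x) x := by
  have : (fun x => c + ∫ t in (0 : ℝ)..x, f t) = fun x => c + ∫ t in (0 : ℝ)..x, f' t := by
    funext y
    rw [intervalIntegral.integral_congr_ae (h.mono fun t ht _ => ht)]
  rw [this]
  exact (intervalIntegral.integral_hasDerivAt_right (hf'.intervalIntegrable _ _)
    hf'.aestronglyMeasurable.stronglyMeasurableAtFilter hf'.continuousAt).const_add c

theorem continuous_primitive_of_locallyIntegrable {f : ℝ → ℝ} (hf : LocallyIntegrable f) (c : ℝ) :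
    Continuous fun x => c + ∫ t in (0 : ℝ)..x, f t :=
  continuous_const.add (intervalIntegral.continuous_primitive (fun _ _ =>
    (hf.integrableOn_isCompact isCompact_uIcc).intervalIntegrable) 0)

/-- Weak `H²` solutions of `(α f'' + β f)'' - (q f')' + r f + σ f'' = 0` are classical. -/
theorem exists_classical_solution {f₀ f₁ f₂ q r : ℝ → ℝ} {α β σ : ℝ} (hα : α ≠ 0)
    (h₀ : IsWeakDeriv f₀ f₁) (h₁ : IsWeakDeriv f₁ f₂) (hq : ContDiff ℝ ∞ q)
    (hr : ContDiff ℝ ∞ r)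
    (hweak : ∀ η, IsTest η →
      (∫ x, (α * f₂ x + β * f₀ x) * deriv (deriv η) x) + (∫ x, q x * f₁ x * deriv η x)
        + ∫ x, (r x * f₀ x + σ * f₂ x) * η x = 0) :
    ∃ u v w z : ℝ → ℝ, f₀ =ᵐ[volume] u ∧ f₁ =ᵐ[volume] v ∧ f₂ =ᵐ[volume] w ∧
      (∀ x, HasDerivAt u (v x) x) ∧ (∀ x, HasDerivAt v (w x) x) ∧ (∀ x, HasDerivAt w (z x) x) ∧
      ∀ x, HasDerivAt z
        ((deriv q x * v x + q x * w x - (r x * u x + σ * w x) - β * w x) / α) x := by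
  have lmul : ∀ {p k : ℝ → ℝ}, Continuous p → LocallyIntegrable k →
      LocallyIntegrable (fun x => p x * k x) := fun hp hk => by
    rw [← locallyIntegrableOn_univ] at hk ⊢
    exact hk.continuousOn_smul isClosed_univ.isLocallyClosed hp.continuousOn
  have lA : LocallyIntegrable fun x => α * f₂ x + β * f₀ x :=
    (lmul continuous_const h₁.2.1).add (lmul continuous_const h₀.1)
  have lB : LocallyIntegrable fun x => q x * f₁ x := lmul hq.continuous h₁.1
  have lC : LocallyIntegrable fun x => r x * f₀ x + σ * f₂ x :=
    (lmul hr.continuous h₀.1).add (lmul continuous_const h₁.2.1)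
  have hD := isWeakDeriv_primitive lC 0
  have hDcont := continuous_primitive_of_locallyIntegrable lC 0
  set D : ℝ → ℝ := fun x => 0 + ∫ t in (0 : ℝ)..x, (r t * f₀ t + σ * f₂ t) with hDdef
  -- With the zeroth-order terms written as `D'`, the equation reads `(α f₂ + β f₀)'' = (q f₁ - D)'`
  -- and can be integrated once.
  obtain ⟨κ, hκ⟩ := exists_isWeakDeriv_add_const (P := fun x => q x * f₁ x - D x) lA
    (lB.sub hD.1) (fun η hη => by
      have e1 := hweak η hη
      have e2 := hD.integral_mul_deriv hη
      have e3 : ∫ x, (q x * f₁ x - D x) * deriv η x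
          = (∫ x, q x * f₁ x * deriv η x) - ∫ x, D x * deriv η x := by
        rw [← integral_sub (hη.deriv.integrable_mul lB) (hη.deriv.integrable_mul hD.1)]
        congr 1; ext x; ring
      rw [e3]
      linarith)
  obtain ⟨a, ha⟩ := hκ.exists_primitive
  obtain ⟨c₁, hc₁⟩ := h₁.exists_primitive
  obtain ⟨c₀, hc₀⟩ := h₀.exists_primitive
  have hucont := continuous_primitive_of_locallyIntegrable h₀.2.1 c₀
  have hvcont := continuous_primitive_of_locallyIntegrable h₁.2.1 c₁
  have hAcont := continuous_primitive_of_locallyIntegrable hκ.2.1 a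
  set u : ℝ → ℝ := fun x => c₀ + ∫ t in (0 : ℝ)..x, f₁ t with hu
  set v : ℝ → ℝ := fun x => c₁ + ∫ t in (0 : ℝ)..x, f₂ t with hv
  set A : ℝ → ℝ := fun x => a + ∫ t in (0 : ℝ)..x, (q t * f₁ t - D t + κ) with hA
  -- Solving for `f₂` gives it a continuous representative; a primitive of a function a.e. equal to
  -- a continuous one is classically differentiable.
  set w : ℝ → ℝ := fun x => (A x - β * u x) / α with hw
  have hf₂ : f₂ =ᵐ[volume] w := by
    filter_upwards [ha, hc₀] with x h1 h2
    have h1 : α * f₂ x + β * f₀ x = A x := h1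
    have h2 : f₀ x = u x := h2
    rw [h2] at h1
    rw [hw]
    field_simp
    linarith
  have hwcont : Continuous w := by fun_prop
  have hu' : ∀ x, HasDerivAt u (v x) x := hasDerivAt_primitive_of_ae_eq hc₁ hvcont c₀
  have hv' : ∀ x, HasDerivAt v (w x) x := hasDerivAt_primitive_of_ae_eq hf₂ hwcont c₁
  have hqc := hq.continuous
  have hrc := hr.continuous
  have hA' : ∀ x, HasDerivAt A (q x * v x - D x + κ) x := by
    refine hasDerivAt_primitive_of_ae_eq ?_ (by fun_prop) a
    filter_upwards [hc₁] with x hx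
    rw [hx]
  have hD' : ∀ x, HasDerivAt D (r x * u x + σ * w x) x := by
    refine hasDerivAt_primitive_of_ae_eq ?_ (by fun_prop) 0
    filter_upwards [hc₀, hf₂] with x h1 h2
    rw [h1, h2]
  refine ⟨u, v, w, fun x => (q x * v x - D x + κ - β * v x) / α, hc₀, hc₁, hf₂, hu', hv',
    fun x => ((hA' x).sub ((hu' x).const_mul β)).div_const α, fun x => ?_⟩
  exact ((((((hq.differentiable (by simp) x).hasDerivAt.mul (hv' x)).sub (hD' x)).add_const κ).sub
    ((hv' x).const_mul β)).div_const α)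

theorem contDiff_of_linear_system {u v w z p₀ p₁ p₂ : ℝ → ℝ} (hu : ∀ x, HasDerivAt u (v x) x)
    (hv : ∀ x, HasDerivAt v (w x) x) (hw : ∀ x, HasDerivAt w (z x) x)
    (hz : ∀ x, HasDerivAt z (p₀ x * u x + p₁ x * v x + p₂ x * w x) x)
    (h₀ : ContDiff ℝ ∞ p₀) (h₁ : ContDiff ℝ ∞ p₁) (h₂ : ContDiff ℝ ∞ p₂) :
    ContDiff ℝ ∞ u ∧ ContDiff ℝ ∞ v ∧ ContDiff ℝ ∞ w ∧ ContDiff ℝ ∞ z := by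
  have step : ∀ {f f' : ℝ → ℝ} {n : ℕ}, (∀ x, HasDerivAt f (f' x) x) → ContDiff ℝ n f' →
      ContDiff ℝ (n + 1 : ℕ) f := fun {f f' n} h hf' => by
    push_cast
    refine contDiff_succ_iff_deriv.2 ⟨fun x => (h x).differentiableAt, by simp, ?_⟩
    rwa [show deriv f = f' from funext fun x => (h x).deriv]
  have key : ∀ n : ℕ, ContDiff ℝ n u ∧ ContDiff ℝ n v ∧ ContDiff ℝ n w ∧ ContDiff ℝ n z := by
    intro n
    induction n with
    | zero =>
      have hc : ∀ {f f' : ℝ → ℝ}, (∀ x, HasDerivAt f (f' x) x) → ContDiff ℝ (0 : ℕ) f :=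
        fun h => contDiff_zero.2 (continuous_iff_continuousAt.2 fun x => (h x).continuousAt)
      exact ⟨hc hu, hc hv, hc hw, hc hz⟩
    | succ n ih =>
      obtain ⟨i1, i2, i3, i4⟩ := ih
      refine ⟨step hu i2, step hv i3, step hw i4, step hz ?_⟩
      exact (((contDiff_infty.1 h₀ n).mul i1).add ((contDiff_infty.1 h₁ n).mul i2)).add
        ((contDiff_infty.1 h₂ n).mul i3)
  exact ⟨contDiff_infty.2 fun n => (key n).1, contDiff_infty.2 fun n => (key n).2.1,
    contDiff_infty.2 fun n => (key n).2.2.1, contDiff_infty.2 fun n => (key n).2.2.2⟩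

/-- If `w, w'' ∈ L²`, then `w' ∈ L²`. -/
theorem memLp_deriv_of_memLp_second_deriv {w z k : ℝ → ℝ} (hw : ∀ x, HasDerivAt w (z x) x)
    (hz : ∀ x, HasDerivAt z (k x) x) (hk : Continuous k) (hw2 : MemLp w 2 volume)
    (hk2 : MemLp k 2 volume) : MemLp z 2 volume := by
  have hwc : Continuous w := continuous_iff_continuousAt.2 fun x => (hw x).continuousAt
  have hzc : Continuous z := continuous_iff_continuousAt.2 fun x => (hz x).continuousAt
  -- Fubini and translation invariance.
  have hint : Integrable fun x => ∫ s in (0 : ℝ)..1, k (x + s) ^ 2 := by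
    have hF : Integrable (fun p : ℝ × ℝ => k (p.1 + p.2) ^ 2)
        (volume.prod (volume.restrict (Set.Ioc (0 : ℝ) 1))) := by
      rw [integrable_prod_iff'
        (by fun_prop : Continuous fun p : ℝ × ℝ => k (p.1 + p.2) ^ 2).aestronglyMeasurable]
      refine ⟨ae_of_all _ fun s => hk2.integrable_sq.comp_add_right s, ?_⟩
      have : (fun s : ℝ => ∫ x, ‖k (x + s) ^ 2‖) = fun _ => ∫ x, ‖k x ^ 2‖ := by
        funext s
        exact integral_add_right_eq_self (fun x => ‖k x ^ 2‖) s
      simp only [this]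
      exact integrable_const _
    simp_rw [intervalIntegral.integral_of_le zero_le_one]
    exact hF.integral_prod_left
  have hpt : ∀ x, z x ^ 2 ≤ 3 * (w (x + 1) ^ 2 + w x ^ 2 + ∫ s in (0 : ℝ)..1, k (x + s) ^ 2) := by
    intro x
    -- Taylor remainder of `w` over a unit step: `w (x + 1) = w x + z x + T`.
    set T := ∫ s in (0 : ℝ)..1, (1 - s) * k (x + s) with hT
    have hTeq : T = w (x + 1) - w x - z x := by
      have hd : ∀ s, HasDerivAt (fun s => w (x + s) + (1 - s) * z (x + s))
          ((1 - s) * k (x + s)) s := fun s => by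
        have h1 := (hw (x + s)).comp_const_add x s
        have h2 := (hz (x + s)).comp_const_add x s
        have h3 : HasDerivAt (fun s : ℝ => 1 - s) (-1) s := (hasDerivAt_id s).const_sub 1
        exact (h1.add (h3.mul h2)).congr_deriv (by ring)
      rw [hT, intervalIntegral.integral_eq_sub_of_hasDerivAt (fun s _ => hd s)
        ((by fun_prop : Continuous fun s => (1 - s) * k (x + s)).intervalIntegrable _ _)]
      simp
      ring
    have hTsq : T ^ 2 ≤ ∫ s in (0 : ℝ)..1, k (x + s) ^ 2 := by
      have h1 : ∫ s in (0 : ℝ)..1, (2 * T) * ((1 - s) * k (x + s))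
          ≤ ∫ s in (0 : ℝ)..1, (T ^ 2 + k (x + s) ^ 2) := by
        refine intervalIntegral.integral_mono_on zero_le_one
          ((by fun_prop : Continuous fun s => (2 * T) * ((1 - s) * k (x + s))).intervalIntegrable _ _)
          ((by fun_prop : Continuous fun s => T ^ 2 + k (x + s) ^ 2).intervalIntegrable _ _)
          fun s hs => ?_
        have h2 : ((1 - s) * k (x + s)) ^ 2 ≤ k (x + s) ^ 2 := by
          rw [mul_pow]
          refine mul_le_of_le_one_left (sq_nonneg _) ?_
          exact pow_le_one₀ (by linarith [hs.2]) (by linarith [hs.1])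
        nlinarith [sq_nonneg (T - (1 - s) * k (x + s))]
      rw [intervalIntegral.integral_const_mul, intervalIntegral.integral_add (by simp)
        ((by fun_prop : Continuous fun s => k (x + s) ^ 2).intervalIntegrable _ _), ← hT] at h1
      simp at h1
      nlinarith
    have hzx : z x = w (x + 1) - w x - T := by rw [hTeq]; ring
    rw [hzx]
    nlinarith [sq_nonneg (w (x + 1) + w x), sq_nonneg (w (x + 1) + T), sq_nonneg (w x - T)]
  rw [memLp_two_iff_integrable_sq hzc.aestronglyMeasurable]
  refine Integrable.mono' ((((hw2.integrable_sq.comp_add_right 1).add hw2.integrable_sq).add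
    hint).const_mul 3) (hzc.pow 2).aestronglyMeasurable (ae_of_all _ fun x => ?_)
  rw [Real.norm_of_nonneg (sq_nonneg _)]
  exact hpt x

theorem memHInfty_of_linear_system {u v w z p₀ p₁ p₂ : ℝ → ℝ} (hu : ∀ x, HasDerivAt u (v x) x)
    (hv : ∀ x, HasDerivAt v (w x) x) (hw : ∀ x, HasDerivAt w (z x) x)
    (hz : ∀ x, HasDerivAt z (p₀ x * u x + p₁ x * v x + p₂ x * w x) x)
    (h₀ : IsMultiplier p₀) (h₁ : IsMultiplier p₁) (h₂ : IsMultiplier p₂)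
    (hu2 : MemLp u 2 volume) (hv2 : MemLp v 2 volume) (hw2 : MemLp w 2 volume) :
    MemHInfty u ∧ MemHInfty v ∧ MemHInfty w ∧ MemHInfty z := by
  obtain ⟨su, sv, sw, sz⟩ := contDiff_of_linear_system hu hv hw hz h₀.smooth h₁.smooth h₂.smooth
  have hkc : Continuous fun x => p₀ x * u x + p₁ x * v x + p₂ x * w x := by
    have := h₀.smooth.continuous
    have := h₁.smooth.continuous
    have := h₂.smooth.continuous
    have := su.continuous
    have := sv.continuous
    have := sw.continuous
    fun_prop
  -- The third derivative is not controlled by `u ∈ H²`. The equation bounds the fourth one in `L²`,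
  -- and interpolation supplies the third.
  have hz2 : MemLp z 2 volume := memLp_deriv_of_memLp_second_deriv hw hz hkc hw2
    (((h₀.mul_memLp hu2).add (h₁.mul_memLp hv2)).add (h₂.mul_memLp hw2))
  have key : ∀ n : ℕ, MemH n u ∧ MemH n v ∧ MemH n w ∧ MemH n z := by
    intro n
    induction n with
    | zero => exact ⟨hu2, hv2, hw2, hz2⟩
    | succ n ih =>
      obtain ⟨i1, i2, i3, i4⟩ := ih
      exact ⟨⟨hu2, v, isWeakDeriv_of_hasDerivAt hu sv.continuous, i2⟩,
        ⟨hv2, w, isWeakDeriv_of_hasDerivAt hv sw.continuous, i3⟩,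
        ⟨hw2, z, isWeakDeriv_of_hasDerivAt hw sz.continuous, i4⟩,
        ⟨hz2, _, isWeakDeriv_of_hasDerivAt hz hkc,
          ((h₀.memH_mul i1).add (h₁.memH_mul i2)).add (h₂.memH_mul i3)⟩⟩
  exact ⟨fun n => (key n).1, fun n => (key n).2.1, fun n => (key n).2.2.1, fun n => (key n).2.2.2⟩

/-! ### From the Euler–Lagrange equation to the normal mode -/

theorem IsTest.inner_toL2 {η : ℝ → ℝ} (hη : IsTest η) (f : L2) :
    ⟪f, hη.toL2⟫ = ∫ x, f x * η x := L2.inner_toLp f (hη.memLp 2)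

theorem IsTest.mulForm_toL2 {m η : ℝ → ℝ} (hm : IsMultiplier m) (hη : IsTest η) (f : L2) :
    mulForm hm f hη.toL2 = ∫ x, m x * f x * η x := by
  rw [mulForm_apply]
  refine integral_congr_ae ?_
  filter_upwards [hη.coeFn_toL2] with x hx
  rw [hx]

/-- The Euler–Lagrange equation of the pencil, tested with a test function. -/
theorem weak_equation_of_pencil_eq_zero {ρ : ℝ → ℝ} (hρ : IsMultiplier ρ) {g μ k c₀ c₁ c₂ s : ℝ}
    {u : sobolevTwo}
    (hu : ∀ y, pencil (formJ hρ k) (formE μ k) (formC c₀ c₁ c₂)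
      (formB hρ.isTest_deriv.isMultiplier (g * k)) s u y = 0) {η : ℝ → ℝ} (hη : IsTest η) :
    (∫ x, ((s * μ + c₂) * u.1.2.2 x + s * μ * k * u.1.1 x) * deriv (deriv η) x)
      + (∫ x, (4 * k * (s * μ) + c₁ + s ^ 2 * ρ x) * u.1.2.1 x * deriv η x)
      + ∫ x, ((c₀ + s * μ * k ^ 2 + (s ^ 2 * k * ρ x + -(g * k) * deriv ρ x)) * u.1.1 x
          + s * μ * k * u.1.2.2 x) * η x = 0 := by
  have h := hu hη.toSobolevTwo
  rw [pencil_apply, formJ_apply, formE_apply, formC_apply, formB_apply] at h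
  simp only [IsTest.toSobolevTwo, inner_add_left, inner_add_right, real_inner_smul_left,
    real_inner_smul_right, IsTest.inner_toL2, IsTest.mulForm_toL2] at h
  have i : ∀ (f : L2) {ζ : ℝ → ℝ}, IsTest ζ → Integrable fun x => f x * ζ x := fun f _ hζ =>
    hζ.integrable_mul (L2.locallyIntegrable f)
  have im : ∀ {m : ℝ → ℝ} (_ : IsMultiplier m) (f : L2) {ζ : ℝ → ℝ}, IsTest ζ →
      Integrable fun x => m x * f x * ζ x := fun hm f _ hζ =>
    integrable_multiplier_mul_mul hm (Lp.memLp f) (hζ.memLp 2)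
  have e1 : ∫ x, ((s * μ + c₂) * u.1.2.2 x + s * μ * k * u.1.1 x) * deriv (deriv η) x
      = (s * μ + c₂) * (∫ x, u.1.2.2 x * deriv (deriv η) x)
        + s * μ * k * ∫ x, u.1.1 x * deriv (deriv η) x := by
    rw [← integral_const_mul, ← integral_const_mul, ← integral_add ((i _ hη.deriv.deriv).const_mul _)
      ((i _ hη.deriv.deriv).const_mul _)]
    congr 1; ext x; ring
  have e2 : ∫ x, (4 * k * (s * μ) + c₁ + s ^ 2 * ρ x) * u.1.2.1 x * deriv η x
      = (4 * k * (s * μ) + c₁) * (∫ x, u.1.2.1 x * deriv η x)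
        + s ^ 2 * ∫ x, ρ x * u.1.2.1 x * deriv η x := by
    rw [← integral_const_mul, ← integral_const_mul, ← integral_add ((i _ hη.deriv).const_mul _)
      ((im hρ _ hη.deriv).const_mul _)]
    congr 1; ext x; ring
  have e3 : ∫ x, ((c₀ + s * μ * k ^ 2 + (s ^ 2 * k * ρ x + -(g * k) * deriv ρ x)) * u.1.1 x
          + s * μ * k * u.1.2.2 x) * η x
      = (c₀ + s * μ * k ^ 2) * (∫ x, u.1.1 x * η x) + s ^ 2 * k * (∫ x, ρ x * u.1.1 x * η x)
        + -(g * k) * (∫ x, deriv ρ x * u.1.1 x * η x) + s * μ * k * ∫ x, u.1.2.2 x * η x := by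
    rw [← integral_const_mul, ← integral_const_mul, ← integral_const_mul, ← integral_const_mul,
      ← integral_add ((i _ hη).const_mul _) ((im hρ _ hη).const_mul _),
      ← integral_add (((i _ hη).const_mul _).fun_add ((im hρ _ hη).const_mul _))
        ((im hρ.isTest_deriv.isMultiplier _ hη).const_mul _),
      ← integral_add ((((i _ hη).const_mul _).fun_add ((im hρ _ hη).const_mul _)).fun_add
        ((im hρ.isTest_deriv.isMultiplier _ hη).const_mul _)) ((i _ hη).const_mul _)]
    congr 1; ext x; ring
  rw [e1, e2, e3]
  linarith

/-- The normal mode generated by a solution `u` of the fourth-order equation. -/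
theorem isNormalMode_of_fourth_order {g μ M s : ℝ} {ρ : ℝ → ℝ} {ξ : Freq} (dir : FieldDir)
    {u v w z z' p : ℝ → ℝ} (hs : 0 < s) (hξ : ξ ≠ 0) (hρ : ContDiff ℝ ∞ ρ)
    (hu : ∀ x, HasDerivAt u (v x) x) (hv : ∀ x, HasDerivAt v (w x) x)
    (hw : ∀ x, HasDerivAt w (z x) x) (hz : ∀ x, HasDerivAt z (z' x) x)
    (heq : ∀ x, (s * μ + magCoeff₂ M dir) * z' x = s ^ 2 * deriv ρ x * v x
      + (4 * ‖ξ‖ ^ 2 * (s * μ) + magCoeff₁ M ξ dir + s ^ 2 * ρ x) * w x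
      - ((magCoeff₀ M ξ dir + s * μ * (‖ξ‖ ^ 2) ^ 2
          + (s ^ 2 * ‖ξ‖ ^ 2 * ρ x + -(g * ‖ξ‖ ^ 2) * deriv ρ x)) * u x + s * μ * ‖ξ‖ ^ 2 * w x)
      - s * μ * ‖ξ‖ ^ 2 * w x)
    (hp : ∀ x, p x = (-s / ‖ξ‖ ^ 2) * (ρ x * v x) + (-(μ + magCoeff₂ M dir / s) * v x
      + ((μ + magCoeff₂ M dir / s) / ‖ξ‖ ^ 2) * z x))
    (su : ContDiff ℝ ∞ u) (sv : ContDiff ℝ ∞ v) (sz : ContDiff ℝ ∞ z)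
    (hu2 : MemLp u 2 volume) (hv2 : MemLp v 2 volume) (hw2 : MemLp w 2 volume) :
    IsNormalMode g μ M ρ dir ξ s (fun x => -ξ 0 / ‖ξ‖ ^ 2 * v x) (fun x => -ξ 1 / ‖ξ‖ ^ 2 * v x)
      u p := by
  have hk0 : ‖ξ‖ ^ 2 ≠ 0 := pow_ne_zero 2 (norm_ne_zero_iff.2 hξ)
  have hks : ‖ξ‖ ^ 2 = ξ 0 ^ 2 + ξ 1 ^ 2 := by
    rw [EuclideanSpace.real_norm_sq_eq, Fin.sum_univ_two]
  set k := ‖ξ‖ ^ 2 with hk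
  have hd : ∀ (c : ℝ) {f f' : ℝ → ℝ}, (∀ x, HasDerivAt f (f' x) x) →
      deriv (fun x => c * f x) = fun x => c * f' x := fun c _ _ h =>
    funext fun x => ((h x).const_mul c).deriv
  have hdu : deriv u = v := funext fun x => (hu x).deriv
  have hdv : deriv v = w := funext fun x => (hv x).deriv
  have hpe : p = fun x => (-s / k) * (ρ x * v x) + (-(μ + magCoeff₂ M dir / s) * v x
      + ((μ + magCoeff₂ M dir / s) / k) * z x) := funext hp
  have hdp : ∀ x, deriv p x = (-s / k) * (deriv ρ x * v x + ρ x * w x)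
      + (-(μ + magCoeff₂ M dir / s) * w x + ((μ + magCoeff₂ M dir / s) / k) * z' x) := fun x => by
    rw [hpe]
    exact ((((hρ.differentiable (by simp) x).hasDerivAt.mul (hv x)).const_mul _).add
      (((hv x).const_mul _).add ((hz x).const_mul _))).deriv
  obtain ⟨ub, ut⟩ := tendsto_zero_of_memLp_deriv hu hu2 hv2
  obtain ⟨vb, vt⟩ := tendsto_zero_of_memLp_deriv hv hv2 hw2
  refine ⟨contDiff_const.mul sv, contDiff_const.mul sv, su, ?_, fun x => ?_, fun x => ?_,
    fun x => ?_, fun x => ?_, by simpa using vb.const_mul (-ξ 0 / k),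
    by simpa using vb.const_mul (-ξ 1 / k), ub, by simpa using vt.const_mul (-ξ 0 / k),
    by simpa using vt.const_mul (-ξ 1 / k), ut⟩
  · rw [hpe]
    exact (contDiff_const.mul (hρ.mul sv)).add
      ((contDiff_const.mul sv).add (contDiff_const.mul sz))
  -- Since `(φ, θ)` is parallel to `ξ`, both horizontal momentum equations are multiples of the
  -- single relation defining `p`; this includes `ξ 0 = 0`.
  · rw [hd _ hv, hd _ hw, hp]
    cases dir <;> simp only [B₁, magCoeff₂, hd _ hv, hd _ hw, hdu] <;> field_simp <;> ring
  · rw [hd _ hv, hd _ hw, hp]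
    cases dir <;> simp only [B₂, magCoeff₂, hd _ hv, hd _ hw, hdu] <;> field_simp <;> ring
  · have h1 := heq x
    have h2 : s * ((μ + magCoeff₂ M dir / s) / k * z' x)
        = (s * μ + magCoeff₂ M dir) * z' x / k := by field_simp
    have h3 : s * deriv p x = (-s ^ 2 / k) * (deriv ρ x * v x + ρ x * w x)
        - (s * μ + magCoeff₂ M dir) * w x + (s * μ + magCoeff₂ M dir) * z' x / k := by
      rw [← h2, hdp]; field_simp; ring
    rw [h3, h1, hdu, hdv]
    cases dir <;> simp only [B₃, magCoeff₀, magCoeff₁, magCoeff₂, hd _ hv, ← hk] <;>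
      field_simp <;> ring
  · rw [hdu]
    field_simp
    rw [hks]
    ring

/-- Regularity of critical points of the pencil: they are smooth, lie in `H^∞` and solve the
Euler–Lagrange equation classically. -/
theorem exists_smooth_representative {ρ : ℝ → ℝ} (hρ : IsMultiplier ρ) {g μ k c₀ c₁ c₂ s : ℝ}
    (hα : 0 < s * μ + c₂) {x : sobolevTwo}
    (hx : ∀ y, pencil (formJ hρ k) (formE μ k) (formC c₀ c₁ c₂)
      (formB hρ.isTest_deriv.isMultiplier (g * k)) s x y = 0) :
    ∃ u v w z z' : ℝ → ℝ, x.1.1 =ᵐ[volume] u ∧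
      (∀ t, HasDerivAt u (v t) t) ∧ (∀ t, HasDerivAt v (w t) t) ∧ (∀ t, HasDerivAt w (z t) t) ∧
      (∀ t, HasDerivAt z (z' t) t) ∧
      (∀ t, (s * μ + c₂) * z' t = s ^ 2 * deriv ρ t * v t
        + (4 * k * (s * μ) + c₁ + s ^ 2 * ρ t) * w t
        - ((c₀ + s * μ * k ^ 2 + (s ^ 2 * k * ρ t + -(g * k) * deriv ρ t)) * u t
          + s * μ * k * w t) - s * μ * k * w t) ∧
      (ContDiff ℝ ∞ u ∧ ContDiff ℝ ∞ v ∧ ContDiff ℝ ∞ w ∧ ContDiff ℝ ∞ z) ∧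
      MemHInfty u ∧ MemHInfty v ∧ MemHInfty w ∧ MemHInfty z := by
  set α := s * μ + c₂ with hαdef
  have hqm : IsMultiplier fun t => 4 * k * (s * μ) + c₁ + s ^ 2 * ρ t :=
    (isMultiplier_const _).add (hρ.const_mul _)
  have hrm : IsMultiplier fun t => c₀ + s * μ * k ^ 2
      + (s ^ 2 * k * ρ t + -(g * k) * deriv ρ t) :=
    (isMultiplier_const _).add ((hρ.const_mul _).add
      (hρ.isTest_deriv.isMultiplier.const_mul _))
  obtain ⟨u, v, w, z, hu0, hv0, hw0, hu, hv, hw, hz⟩ := exists_classical_solution hα.ne'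
    x.2.1 x.2.2 hqm.smooth hrm.smooth (fun η hη => weak_equation_of_pencil_eq_zero hρ hx hη)
  have hq' : ∀ t, deriv (fun t => 4 * k * (s * μ) + c₁ + s ^ 2 * ρ t) t
      = s ^ 2 * deriv ρ t := fun t =>
    ((((hρ.smooth.differentiable (by simp) t).hasDerivAt).const_mul (s ^ 2)).const_add _).deriv
  have hu2 : MemLp u 2 volume := (memLp_congr_ae hu0).1 (Lp.memLp _)
  have hv2 : MemLp v 2 volume := (memLp_congr_ae hv0).1 (Lp.memLp _)
  have hw2 : MemLp w 2 volume := (memLp_congr_ae hw0).1 (Lp.memLp _)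
  have hp₀ := hrm.const_mul (-1 / α)
  have hp₁ := hρ.isTest_deriv.isMultiplier.const_mul (s ^ 2 / α)
  have hp₂ := (hqm.add (isMultiplier_const (-(2 * (s * μ * k))))).const_mul (1 / α)
  have hz' : ∀ t, HasDerivAt z
      ((-1 / α * (c₀ + s * μ * k ^ 2 + (s ^ 2 * k * ρ t + -(g * k) * deriv ρ t))) * u t
        + (s ^ 2 / α * deriv ρ t) * v t
        + (1 / α * (4 * k * (s * μ) + c₁ + s ^ 2 * ρ t + -(2 * (s * μ * k)))) * w t) t := fun t => by
    refine (hz t).congr_deriv ?_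
    rw [hq']
    field_simp
    ring
  refine ⟨u, v, w, z, _, hu0, hu, hv, hw, hz, fun t => ?_,
    contDiff_of_linear_system hu hv hw hz' hp₀.smooth hp₁.smooth hp₂.smooth,
    memHInfty_of_linear_system hu hv hw hz' hp₀ hp₁ hp₂ hu2 hv2 hw2⟩
  rw [hq', mul_div_cancel₀ _ hα.ne']

end RTMHD

end

theorem theorem2p2 (g μ M : ℝ) (hg : 0 < g) (hμ : 0 < μ) (ρ : ℝ → ℝ)
    (hρ : RTMHD.IsRTProfile ρ) (dir : RTMHD.FieldDir) (hM : RTMHD.AdmissibleField g ρ M dir)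
    (ξ : RTMHD.Freq) (hξ : ξ ∈ RTMHD.solvableDomain g M ρ dir) :
    ∃ lam : ℝ, 0 < lam ∧ RTMHD.IsGrowthRate g μ M ρ dir ξ lam ∧
      ∃ φ θ ψ p : ℝ → ℝ, RTMHD.IsNormalMode g μ M ρ dir ξ lam φ θ ψ p ∧
        RTMHD.MemHInfty φ ∧ RTMHD.MemHInfty θ ∧ RTMHD.MemHInfty ψ ∧ RTMHD.MemHInfty p ∧
        ψ ∈ RTMHD.admissibleSet ρ ξ := by
  open RTMHD in
  obtain ⟨hξ0, x₀, hx₀⟩ := exists_formC_lt_formB hg hρ dir hM hξ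
  have hk : 0 < ‖ξ‖ ^ 2 := by have := norm_pos_iff.2 hξ0; positivity
  have hρm := hρ.isMultiplier
  have h₂ := magCoeff₂_nonneg M dir
  obtain ⟨s, hs, hnn, x, hJ, hker⟩ := exists_growth_parameter hρ hg hμ hk
    (magCoeff₀_nonneg M ξ dir) (magCoeff₁_nonneg M ξ dir) h₂ hx₀
  obtain ⟨u, v, w, z, z', hu0, hu, hv, hw, hz, heq, ⟨su, sv, -, sz⟩, mu, mv, mw, mz⟩ :=
    exists_smooth_representative hρm (by positivity) hker
  have hadm : u ∈ admissibleSet ρ ξ := ⟨memH_two_of_ae_eq hu0, (J_eq_formJ hρm hu0 ξ).trans hJ⟩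
  refine ⟨s, hs, ⟨hs, ?_, ?_⟩, _, _, u, _, isNormalMode_of_fourth_order dir hs hξ0 hρ.smooth hu hv
    hw hz heq (fun t => rfl) su sv sz (mu 0) (mv 0) (mw 0), fun n => (mv n).const_mul _,
    fun n => (mv n).const_mul _, mu, fun n => ?_, hadm⟩
  -- With `J = 1`, nonnegativity of the pencil reads `E ≥ -s²`; its vanishing at the kernel element
  -- gives equality there.
  · rintro _ ⟨ψ, ⟨hψ, hψJ⟩, rfl⟩
    obtain ⟨y, hy⟩ := hψ.exists_sobolevTwo
    have := hnn y
    rw [pencil_apply, ← J_eq_formJ hρm hy ξ, hψJ] at this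
    rw [E_eq_forms hρm hy g μ M hξ0 dir]
    linarith
  · intro b hb
    refine (hb ⟨u, hadm, rfl⟩).trans ?_
    have := hker x
    rw [pencil_apply, hJ] at this
    rw [E_eq_forms hρm hu0 g μ M hξ0 dir]
    linarith
  · exact ((hρm.memH_mul (mv n)).const_mul _).add (((mv n).const_mul _).add ((mz n).const_mul _))
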